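/- A groupoid is a set $G$ with a set $G^{(2)}\subseteq G\times G$ of composable pairs, a product $G^{(2)}\to G$ and an inversion $g\mapsto g^{-1}$ satisfying the usual axioms; write $r(g)=gg^{-1}$, $d(g)=g^{-1}g$, let $G^{(0)}=\{gg^{-1}: g\in G\}$ be its set of units, and for $u\in G^{(0)}$ put $G_u=\{g\in G: d(g)=u\}$, $G^u=\{g\in G: r(g)=u\}$ and $G_u^u=G_u\cap G^u$. Let $G$ be an étale groupoid, i.e. a groupoid with a locally compact Hausdorff topology for which the product and the inversion are continuous and which has a basis of open bisections (open sets on which $r$ and $d$ restrict to homeomorphisms onto open subsets of $G$). Let $C_r^*(G)$ be the reduced groupoid $C^*$-algebra, i.e. the completion of the convolution $*$-algebra $C_c(G)$, $$(f_1*f_2)(g)=\sum_{h\in G^{r(g)}}f_1(h)f_2(h^{-1}g),\qquad f^*(g)=\overline{f(g^{-1})},$$ in the norm $\|f\|_r=\sup_{u\in G^{(0)}}\|\pi_u(f)\|$, where $\pi_u(f)\xi=f*\xi$ for $\xi\in\ell^2(G_u)$. Suppose that there is a unit $u\in G^{(0)}$ with trivial isotropy, $G_u^u=\{u\}$. Then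 $C_r^*(G)$ is simple (that is, it is nonzero and its only closed two-sided ideals are $\{0\}$ and $C_r^*(G)$) if and only if $G$ is minimal (that is, the only closed subsets $D\subseteq G^{(0)}$ that are invariant, meaning that $d(g)\in D$ implies $r(g)\in D$ for all $g\in G$, are $\emptyset$ and $G^{(0)}$). -/

import Mathlib

open scoped ENNReal

namespace Gpd

universe u

/-- A groupoid, given by its set `G` of arrows: a set of composable pairs, a product defined on the
composable pairs and an inversion.  The product is recorded as a total function; its values on
pairs that are not composable are arbitrary and are never used. -/
class Groupoid (G : Type u) extends Mul G, Inv G where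
  /-- `Composable g h` says that `(g, h)` is a composable pair. -/
  Composable : G → G → Prop
  composable_mul_left : ∀ {g₁ g₂ g₃ : G}, Composable g₁ g₂ → Composable g₂ g₃ →
    Composable (g₁ * g₂) g₃
  composable_mul_right : ∀ {g₁ g₂ g₃ : G}, Composable g₁ g₂ → Composable g₂ g₃ →
    Composable g₁ (g₂ * g₃)
  assoc : ∀ {g₁ g₂ g₃ : G}, Composable g₁ g₂ → Composable g₂ g₃ →
    (g₁ * g₂) * g₃ = g₁ * (g₂ * g₃)
  composable_inv : ∀ g : G, Composable g g⁻¹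
  inv_cancel_left : ∀ {g h : G}, Composable g h →
    Composable g⁻¹ (g * h) ∧ g⁻¹ * (g * h) = h
  inv_cancel_right : ∀ {g h : G}, Composable g h →
    Composable (g * h) h⁻¹ ∧ (g * h) * h⁻¹ = g

section Algebra

variable {G : Type u} [Groupoid G]

/-- The range map. -/
def r (g : G) : G := g * g⁻¹

/-- The domain map. -/
def d (g : G) : G := g⁻¹ * g

variable (G) in
/-- The set of units `G⁰`. -/
def units : Set G := {u | ∃ g : G, u = g * g⁻¹}

/-- The isotropy `G_u^u` at `u`. -/
def isotropy (u : G) : Set G := {g | d g = u ∧ r g = u}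

/-- A set of units is invariant if it contains `r g` whenever it contains `d g`. -/
def IsInvariant (D : Set (units G)) : Prop :=
  ∀ g : G, d g ∈ Subtype.val '' D → r g ∈ Subtype.val '' D

open Groupoid

theorem inv_composable_self (g : G) : Composable g⁻¹ g ∧ g⁻¹⁻¹ = g := by
  have h1 := composable_inv g
  have h2 := composable_inv g⁻¹
  have h3 : g * (g⁻¹ * g⁻¹⁻¹) = g := (assoc h1 h2).symm.trans (inv_cancel_right h1).2
  have h4 := inv_cancel_left (composable_mul_right h1 h2)
  rw [h3] at h4
  refine ⟨h4.1, ?_⟩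
  have h5 := (inv_cancel_left h4.1).2
  rw [h4.2] at h5
  exact (inv_cancel_left h2).2.symm.trans h5

theorem inv_inv' (g : G) : g⁻¹⁻¹ = g := (inv_composable_self g).2

theorem r_inv (g : G) : r g⁻¹ = d g := by simp [r, d, inv_inv']

theorem d_inv (g : G) : d g⁻¹ = r g := by simp [r, d, inv_inv']

theorem r_mul_self (g : G) : r g * g = g := by
  have h := (inv_cancel_right (composable_inv g)).2
  rwa [inv_inv'] at h

theorem mul_d_self (g : G) : g * d g = g :=
  (assoc (composable_inv g) (inv_composable_self g).1).symm.trans (r_mul_self g)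

theorem composable_iff {g h : G} : Composable g h ↔ d g = r h := by
  constructor
  · intro H
    have h1 := inv_cancel_left H
    have h2 := inv_cancel_right H
    have h3 := assoc h1.1 h2.1
    rw [h1.2, h2.2] at h3
    exact h3.symm
  · intro H
    have h1 : Composable g (d g) :=
      composable_mul_right (composable_inv g) (inv_composable_self g).1
    have h2 : Composable (r h) h :=
      composable_mul_left (composable_inv h) (inv_composable_self h).1
    rw [← H] at h2
    have h3 := composable_mul_left h1 h2
    rwa [mul_d_self] at h3

theorem r_mul {g h : G} (H : d g = r h) : r (g * h) = r g := by
  have H := composable_iff.2 H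
  have h1 := inv_cancel_left H
  have h2 := composable_iff.1 h1.1
  rw [d_inv] at h2
  exact h2.symm

theorem d_mul {g h : G} (H : d g = r h) : d (g * h) = d h := by
  have h2 := composable_iff.1 (inv_cancel_right (composable_iff.2 H)).1
  rwa [r_inv] at h2

theorem mul_assoc' {a b c : G} (h1 : d a = r b) (h2 : d b = r c) :
    (a * b) * c = a * (b * c) := assoc (composable_iff.2 h1) (composable_iff.2 h2)

theorem inv_mul_cancel_left' {g h : G} (H : d g = r h) : g⁻¹ * (g * h) = h :=
  (inv_cancel_left (composable_iff.2 H)).2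

theorem mul_inv_cancel_left' {g h : G} (H : r g = r h) : g * (g⁻¹ * h) = h := by
  have := inv_mul_cancel_left' (g := g⁻¹) (h := h) (by rw [d_inv, H])
  rwa [inv_inv'] at this

theorem mul_inv_cancel_right' {g h : G} (H : d g = r h) : (g * h) * h⁻¹ = g :=
  (inv_cancel_right (composable_iff.2 H)).2

theorem inv_mul_cancel_right' {g h : G} (H : d g = d h) : (g * h⁻¹) * h = g := by
  have := mul_inv_cancel_right' (g := g) (h := h⁻¹) (by rw [r_inv, H])
  rwa [inv_inv'] at this

theorem mul_inv_rev' {g h : G} (H : d g = r h) : (g * h)⁻¹ = h⁻¹ * g⁻¹ := by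
  have h1 : d (g * h)⁻¹ = r g := by rw [d_inv, r_mul H]
  have h2 : (g * h)⁻¹ * g = h⁻¹ := by
    have h3 := mul_inv_cancel_right' (g := (g * h)⁻¹ * g) (h := h)
      (by rw [d_mul h1, H])
    rw [mul_assoc' h1 H] at h3
    rw [← h3]
    have := mul_inv_cancel_right' (g := (g*h)⁻¹) (h := g * h) (by rw [d_inv])
    have h5 : (g * h)⁻¹ * (g * h) = d h := by rw [← d_mul H]; rfl
    rw [h5, ← r_inv, r_mul_self]
  rw [← h2]
  exact (mul_inv_cancel_right' h1).symm

theorem r_inv_mul {h g : G} (H : r h = r g) : r (h⁻¹ * g) = d h := by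
  rw [r_mul (by rw [d_inv, H]), r_inv]

theorem d_inv_mul {h g : G} (H : r h = r g) : d (h⁻¹ * g) = d g :=
  d_mul (by rw [d_inv, H])

theorem r_mul_inv {g k : G} (H : d g = d k) : r (g * k⁻¹) = r g :=
  r_mul (by rw [r_inv, H])

theorem d_mul_inv {g k : G} (H : d g = d k) : d (g * k⁻¹) = r k := by
  rw [d_mul (by rw [r_inv, H]), d_inv]

theorem mul_inv_injective {g a b : G} (ha : d g = d a) (hb : d g = d b)
    (e : g * a⁻¹ = g * b⁻¹) : a = b := by
  have h1 := inv_mul_cancel_left' (g := g) (h := a⁻¹) (by rw [r_inv, ha])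
  rw [e, inv_mul_cancel_left' (by rw [r_inv, hb])] at h1
  rw [← inv_inv' a, ← h1, inv_inv']

theorem mem_units_iff {u : G} : u ∈ units G ↔ r u = u := by
  constructor
  · rintro ⟨g, rfl⟩
    exact r_mul (by rw [r_inv])
  · intro h
    exact ⟨u, h.symm⟩

/-- The convolution product
`(f * ξ)(g) = ∑_{h ∈ G^{r(g)}} f(h) ξ(h⁻¹ g)`, whenever the sum has finitely many nonzero terms. -/
noncomputable def conv (f ξ : G → ℂ) (g : G) : ℂ :=
  ∑ᶠ h ∈ {h : G | r h = r g}, f h * ξ (h⁻¹ * g)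

/-- `f` has finite support on every `G^x`. -/
def FiniteOnFibers (f : G → ℂ) : Prop := ∀ x : G, {h : G | r h = x ∧ f h ≠ 0}.Finite

theorem conv_eq_sum (f ξ : G → ℂ) (g : G) (s : Finset G) (hs : ∀ h ∈ s, r h = r g)
    (hs' : ∀ h, r h = r g → f h ≠ 0 → h ∈ s) : conv f ξ g = ∑ h ∈ s, f h * ξ (h⁻¹ * g) := by
  refine finsum_mem_eq_sum_of_inter_support_eq _ ?_
  ext h
  simp only [Set.mem_inter_iff, Set.mem_ofPred_eq, Function.mem_support, Finset.mem_coe]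
  constructor
  · rintro ⟨h1, h2⟩
    exact ⟨hs' h h1 (left_ne_zero_of_mul h2), h2⟩
  · rintro ⟨h1, h2⟩
    exact ⟨hs h h1, h2⟩

theorem conv_eq_sum' {f : G → ℂ} (hf : FiniteOnFibers f) (ξ : G → ℂ) (g : G) :
    conv f ξ g = ∑ h ∈ (hf (r g)).toFinset, f h * ξ (h⁻¹ * g) :=
  conv_eq_sum f ξ g _ (fun h hh => ((hf _).mem_toFinset.1 hh).1) fun h e e' => by simp [e, e']

/-- The convolution as a sum over `G_{d(g)}`. -/
theorem conv_eq_finsum_domain (f ξ : G → ℂ) (g : G) :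
    conv f ξ g = ∑ᶠ k ∈ {k : G | d k = d g}, f (g * k⁻¹) * ξ k := by
  refine finsum_mem_eq_of_bijOn (fun h => h⁻¹ * g) ⟨?_, ?_, ?_⟩ ?_
  · intro h hh
    exact d_inv_mul hh
  · intro h hh h' hh' e
    simp only [Set.mem_ofPred_eq] at hh hh' e
    have e1 : h⁻¹ = h'⁻¹ := by
      rw [← mul_inv_cancel_right' (g := h⁻¹) (h := g) (by rw [d_inv, hh]), e,
        mul_inv_cancel_right' (by rw [d_inv, hh'])]
    rw [← inv_inv' h, e1, inv_inv']
  · intro k hk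
    simp only [Set.mem_ofPred_eq] at hk
    refine ⟨g * k⁻¹, r_mul_inv hk.symm, ?_⟩
    simp only
    rw [mul_inv_rev' (by rw [r_inv, hk]), inv_inv']
    exact inv_mul_cancel_right' hk
  · intro h hh
    simp only [Set.mem_ofPred_eq] at hh
    congr 2
    rw [mul_inv_rev' (by rw [d_inv, hh]), inv_inv', mul_inv_cancel_left' hh.symm]

theorem conv_add_left {f₁ f₂ : G → ℂ} (h₁ : FiniteOnFibers f₁) (h₂ : FiniteOnFibers f₂)
    (ξ : G → ℂ) : conv (f₁ + f₂) ξ = conv f₁ ξ + conv f₂ ξ := by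
  classical
  funext g
  have hs : ∀ h ∈ (h₁ (r g)).toFinset ∪ (h₂ (r g)).toFinset, r h = r g := by
    intro h hh
    simp only [Finset.mem_union, Set.Finite.mem_toFinset, Set.mem_ofPred_eq] at hh
    tauto
  rw [Pi.add_apply, conv_eq_sum _ ξ g _ hs, conv_eq_sum _ ξ g _ hs, conv_eq_sum _ ξ g _ hs,
    ← Finset.sum_add_distrib]
  · exact Finset.sum_congr rfl fun h _ => by simp [add_mul]
  · intro h e e'
    simp [e, e']
  · intro h e e'
    simp [e, e']
  · intro h e e'
    simp only [Finset.mem_union, Set.Finite.mem_toFinset, Set.mem_ofPred_eq, e, true_and]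
    by_contra! hc
    exact e' (by simp [hc.1, hc.2])

theorem conv_add_right {f : G → ℂ} (hf : FiniteOnFibers f) (ξ η : G → ℂ) :
    conv f (ξ + η) = conv f ξ + conv f η := by
  funext g
  simp only [Pi.add_apply, conv_eq_sum' hf, mul_add, Finset.sum_add_distrib]

theorem conv_smul_left (c : ℂ) (f ξ : G → ℂ) : conv (c • f) ξ = c • conv f ξ := by
  funext g
  simp only [conv, Pi.smul_apply, smul_eq_mul, mul_assoc]
  exact (mul_finsum_mem _ _).symm

theorem conv_smul_right (c : ℂ) (f ξ : G → ℂ) : conv f (c • ξ) = c • conv f ξ := by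
  funext g
  simp only [conv, Pi.smul_apply, smul_eq_mul, mul_left_comm _ c]
  exact (mul_finsum_mem _ _).symm

theorem conv_assoc {f₁ f₂ : G → ℂ} (h₁ : FiniteOnFibers f₁) (h₂ : FiniteOnFibers f₂)
    (ξ : G → ℂ) : conv (conv f₁ f₂) ξ = conv f₁ (conv f₂ ξ) := by
  classical
  funext g
  set S := (h₁ (r g)).toFinset with hS
  have memS : ∀ k, k ∈ S ↔ r k = r g ∧ f₁ k ≠ 0 := by simp [hS]
  set H : Finset G := S.biUnion fun k => ((h₂ (d k)).toFinset).image fun l => k * l with hH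
  have memH : ∀ h, h ∈ H ↔ ∃ k ∈ S, ∃ l, (r l = d k ∧ f₂ l ≠ 0) ∧ k * l = h := by simp [hH]
  have hHr : ∀ h ∈ H, r h = r g := by
    intro h hh
    obtain ⟨k, hk, l, ⟨hl, -⟩, rfl⟩ := (memH h).1 hh
    rw [r_mul hl.symm, ((memS k).1 hk).1]
  have conv_h : ∀ h, r h = r g → conv f₁ f₂ h = ∑ k ∈ S, f₁ k * f₂ (k⁻¹ * h) := by
    intro h hh
    refine conv_eq_sum _ _ _ _ ?_ ?_
    · intro k hk
      rw [hh, ((memS k).1 hk).1]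
    · intro k hk hk'
      exact (memS k).2 ⟨hk.trans hh, hk'⟩
  rw [conv_eq_sum (conv f₁ f₂) ξ g H hHr, conv_eq_sum' h₁]
  · rw [Finset.sum_congr rfl fun h hh => by rw [conv_h h (hHr h hh), Finset.sum_mul],
      Finset.sum_comm]
    refine Finset.sum_congr rfl fun k hk => ?_
    have hkr := ((memS k).1 hk).1
    simp only [mul_assoc]
    rw [← Finset.mul_sum]
    congr 1
    rw [conv]
    symm
    trans ∑ᶠ h ∈ {h : G | r h = r g}, f₂ (k⁻¹ * h) * ξ (h⁻¹ * g)
    · refine finsum_mem_eq_of_bijOn (fun l => k * l) ⟨?_, ?_, ?_⟩ ?_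
      · intro l hl
        simp only [Set.mem_ofPred_eq, r_inv_mul hkr] at hl ⊢
        rw [r_mul hl.symm, hkr]
      · intro l hl l' hl' e
        simp only [Set.mem_ofPred_eq, r_inv_mul hkr] at hl hl' e
        rw [← inv_mul_cancel_left' hl.symm, e, inv_mul_cancel_left' hl'.symm]
      · intro h hh
        simp only [Set.mem_ofPred_eq] at hh
        refine ⟨k⁻¹ * h, ?_, mul_inv_cancel_left' (hkr.trans hh.symm)⟩
        simp only [Set.mem_ofPred_eq]
        rw [r_inv_mul hkr, r_inv_mul (hkr.trans hh.symm)]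
      · intro l hl
        simp only [Set.mem_ofPred_eq, r_inv_mul hkr] at hl
        rw [inv_mul_cancel_left' hl.symm, mul_inv_rev' hl.symm,
          mul_assoc' (by rw [d_inv, hl, r_inv]) (by rw [d_inv, hkr])]
    · refine finsum_mem_eq_sum_of_inter_support_eq _ ?_
      ext h
      simp only [Set.mem_inter_iff, Set.mem_ofPred_eq, Function.mem_support, Finset.mem_coe]
      constructor
      · rintro ⟨hh, h2⟩
        refine ⟨(memH h).2 ⟨k, hk, k⁻¹ * h, ⟨?_, left_ne_zero_of_mul h2⟩, ?_⟩, h2⟩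
        · rw [r_inv_mul (hkr.trans hh.symm)]
        · rw [mul_inv_cancel_left' (hkr.trans hh.symm)]
      · rintro ⟨hh, h2⟩
        exact ⟨hHr h hh, h2⟩
  · intro h hh hne
    rw [conv_h h hh] at hne
    obtain ⟨k, hk, hk'⟩ := Finset.exists_ne_zero_of_sum_ne_zero hne
    have hkr := ((memS k).1 hk).1.trans hh.symm
    exact (memH h).2 ⟨k, hk, k⁻¹ * h, ⟨r_inv_mul hkr, right_ne_zero_of_mul hk'⟩,
      mul_inv_cancel_left' hkr⟩

/-- The involution `f*(g) = conj (f (g⁻¹))`. -/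
noncomputable def invol (f : G → ℂ) (g : G) : ℂ := (starRingEnd ℂ) (f g⁻¹)

theorem conv_invol (f₁ f₂ : G → ℂ) (hf : FiniteOnFibers f₁) :
    invol (conv f₁ f₂) = conv (invol f₂) (invol f₁) := by
  funext g
  rw [conv_eq_finsum_domain, invol, conv_eq_sum' hf, map_sum]
  symm
  trans ∑ᶠ h ∈ {h : G | r h = r g⁻¹}, (starRingEnd ℂ) (f₁ h * f₂ (h⁻¹ * g⁻¹))
  · refine finsum_mem_eq_of_bijOn (fun k => k⁻¹) ⟨?_, ?_, ?_⟩ ?_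
    · intro k hk
      simp only [Set.mem_ofPred_eq, r_inv] at hk ⊢
      exact hk
    · intro k _ k' _ e
      simp only at e
      rw [← inv_inv' k, e, inv_inv']
    · intro h hh
      simp only [Set.mem_ofPred_eq, r_inv] at hh
      exact ⟨h⁻¹, by simpa [d_inv] using hh, inv_inv' h⟩
    · intro k hk
      simp only [Set.mem_ofPred_eq] at hk
      simp only [invol, map_mul]
      rw [mul_comm, inv_inv', mul_inv_rev' (by rw [r_inv, hk]), inv_inv']
  · refine finsum_mem_eq_sum_of_inter_support_eq _ ?_
    ext h
    simp only [Set.mem_inter_iff, Set.mem_ofPred_eq, Function.mem_support, Finset.mem_coe,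
      Set.Finite.mem_toFinset, ne_eq, map_eq_zero]
    constructor
    · rintro ⟨h1, h2⟩
      exact ⟨⟨h1, left_ne_zero_of_mul h2⟩, h2⟩
    · rintro ⟨h1, h2⟩
      exact ⟨h1.1, h2⟩

open Classical in
/-- Extension by zero of a function on `G_u`. -/
noncomputable def extendZero {u : G} (ξ : {g : G // d g = u} → ℂ) (g : G) : ℂ :=
  if h : d g = u then ξ ⟨g, h⟩ else 0

theorem conv_extendZero (f : G → ℂ) {u : G} (ξ : {g : G // d g = u} → ℂ)
    (g : {g : G // d g = u}) (T : Finset {g : G // d g = u})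
    (hT : ∀ k : {g : G // d g = u}, f (g.1 * k.1⁻¹) ≠ 0 → k ∈ T) :
    conv f (extendZero ξ) g.1 = ∑ k ∈ T, f (g.1 * k.1⁻¹) * ξ k := by
  rw [conv_eq_finsum_domain]
  have h1 : {k : G | d k = d g.1} = {k : G | d k = u} := by rw [g.2]
  rw [h1, ← finsum_set_coe_eq_finsum_mem]
  have h2 : ∀ k : {g : G // d g = u}, extendZero ξ k.1 = ξ k := fun k => by
    simp [extendZero, k.2]
  trans ∑ᶠ k : {g : G // d g = u}, f (g.1 * k.1⁻¹) * ξ k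
  · exact finsum_congr fun k => by rw [← h2 k]
  · refine finsum_eq_sum_of_support_subset _ fun k hk => ?_
    exact hT k (left_ne_zero_of_mul hk)

end Algebra

section Space

/-- The space `C_c(G)` of compactly supported continuous functions, to be equipped with the
convolution product and the involution of a groupoid. -/
def ConvAlgebra (G : Type u) [TopologicalSpace G] : Type u := CompactlySupportedContinuousMap G ℂ

namespace ConvAlgebra

variable {G : Type u} [TopologicalSpace G]

noncomputable instance : AddCommGroup (ConvAlgebra G) :=
  inferInstanceAs (AddCommGroup (CompactlySupportedContinuousMap G ℂ))

noncomputable instance : Module ℂ (ConvAlgebra G) :=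
  inferInstanceAs (Module ℂ (CompactlySupportedContinuousMap G ℂ))

instance : FunLike (ConvAlgebra G) G ℂ :=
  inferInstanceAs (FunLike (CompactlySupportedContinuousMap G ℂ) G ℂ)

theorem ext {f g : ConvAlgebra G} (h : (f : G → ℂ) = g) : f = g := DFunLike.coe_injective h

theorem coe_add (f g : ConvAlgebra G) : ⇑(f + g) = (f : G → ℂ) + g := rfl

theorem coe_smul (c : ℂ) (f : ConvAlgebra G) : ⇑(c • f) = c • (f : G → ℂ) := rfl

theorem coe_zero : ⇑(0 : ConvAlgebra G) = (0 : G → ℂ) := rfl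

theorem continuous (f : ConvAlgebra G) : Continuous f :=
  ContinuousMap.continuous (CompactlySupportedContinuousMap.toContinuousMap f)

theorem hasCompactSupport (f : ConvAlgebra G) : HasCompactSupport f :=
  CompactlySupportedContinuousMap.hasCompactSupport' f

end ConvAlgebra

end Space

section Topology

variable {G : Type u} [TopologicalSpace G] [Groupoid G]

/-- An open bisection: an open set on which `r` and `d` are homeomorphisms onto open subsets. -/
def IsOpenBisection (S : Set G) : Prop :=
  IsOpen S ∧ Topology.IsOpenEmbedding (S.domRestrict (r : G → G)) ∧
    Topology.IsOpenEmbedding (S.domRestrict (d : G → G))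

variable (G) in
/-- An étale groupoid: a locally compact Hausdorff groupoid with continuous product and inversion
whose topology has a basis of open bisections. -/
class IsEtale : Prop extends T2Space G, LocallyCompactSpace G where
  continuousOn_mul :
    ContinuousOn (fun p : G × G => p.1 * p.2) {p | Groupoid.Composable p.1 p.2}
  continuous_inv : Continuous fun g : G => g⁻¹
  isTopologicalBasis : TopologicalSpace.IsTopologicalBasis {S : Set G | IsOpenBisection S}

variable (G) in
/-- `G` is minimal if the only closed invariant subsets of `G⁰` are `∅` and `G⁰`. -/
def IsMinimal : Prop :=
  ∀ D : Set (units G), IsClosed D → IsInvariant D → D = ∅ ∨ D = Set.univ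

variable [IsEtale G]

theorem continuous_r : Continuous (r : G → G) :=
  IsEtale.continuousOn_mul.comp_continuous
    (continuous_id.prodMk IsEtale.continuous_inv) fun g => Groupoid.composable_inv g

theorem continuous_d : Continuous (d : G → G) :=
  IsEtale.continuousOn_mul.comp_continuous
    (IsEtale.continuous_inv.prodMk continuous_id) fun g => (inv_composable_self g).1

theorem exists_bisection (g : G) {U : Set G} (hU : IsOpen U) (hg : g ∈ U) :
    ∃ S, IsOpenBisection S ∧ g ∈ S ∧ S ⊆ U :=
  IsEtale.isTopologicalBasis.exists_subset_of_mem_open hg hU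

theorem exists_card_le {K : Set G} (hK : IsCompact K) :
    ∃ n : ℕ, ∀ (x : G) (s : Finset G), (∀ h ∈ s, h ∈ K ∧ r h = x) → s.card ≤ n := by
  classical
  choose S hS hmem _ using fun g : G => exists_bisection g isOpen_univ (Set.mem_univ g)
  obtain ⟨t, ht⟩ := hK.elim_finite_subcover S (fun g => (hS g).1)
    (fun g _ => Set.mem_iUnion.2 ⟨g, hmem g⟩)
  refine ⟨t.card, fun x s hs => ?_⟩
  have h1 : ∀ h ∈ s, ∃ g ∈ t, h ∈ S g := by
    intro h hh
    simpa using ht (hs h hh).1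
  choose! c hc hc' using h1
  refine Finset.card_le_card_of_injOn c hc ?_
  intro a ha b hb e
  have hb' := hc' b hb
  rw [← e] at hb'
  have := (hS (c a)).2.1.injective (a₁ := ⟨a, hc' a ha⟩) (a₂ := ⟨b, hb'⟩)
    (by simp [(hs a ha).2, (hs b hb).2])
  simpa using this

theorem exists_card_le' {K : Set G} (hK : IsCompact K) :
    ∃ n : ℕ, ∀ (x : G) (s : Finset G), (∀ h ∈ s, h ∈ K ∧ d h = x) → s.card ≤ n := by
  classical
  obtain ⟨n, hn⟩ := exists_card_le (hK.image IsEtale.continuous_inv)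
  refine ⟨n, fun x s hs => ?_⟩
  have := hn x (s.image fun g => g⁻¹) ?_
  · rwa [Finset.card_image_of_injective] at this
    intro a b e
    rw [← inv_inv' a, show a⁻¹ = b⁻¹ from e, inv_inv']
  · intro h hh
    obtain ⟨k, hk, rfl⟩ := Finset.mem_image.1 hh
    exact ⟨⟨k, (hs k hk).1, rfl⟩, by rw [r_inv, (hs k hk).2]⟩

theorem finite_fiber {K : Set G} (hK : IsCompact K) (x : G) : {h : G | r h = x ∧ h ∈ K}.Finite := by
  obtain ⟨n, hn⟩ := exists_card_le hK
  by_contra hinf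
  obtain ⟨s, hs, hcard⟩ := Set.Infinite.exists_subset_card_eq hinf (n + 1)
  have := hn x s fun h hh => ⟨(hs hh).2, (hs hh).1⟩
  omega

/-- Sums over the fibers of `r` of compactly supported functions vary continuously. -/
theorem continuous_fiber_sum {f : G → ℂ} (hf : Continuous f) (hf' : HasCompactSupport f)
    {Φ : G → G → ℂ}
    (hΦ : ContinuousOn (fun p : G × G => Φ p.1 p.2) {p | r p.1 = r p.2}) :
    Continuous fun g => ∑ᶠ h ∈ {h : G | r h = r g}, f h * Φ h g := by
  classical
  rw [continuous_iff_continuousAt]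
  intro g₀
  have hfin := finite_fiber hf'.isCompact (r g₀)
  obtain ⟨U, hU, hdisj⟩ := hfin.t2_separation
  choose S hS hmem hsub using fun h : G => exists_bisection h (hU h).2 (hU h).1
  set F := hfin.toFinset with hF
  have memF : ∀ h, h ∈ F ↔ r h = r g₀ ∧ h ∈ tsupport f := by simp [hF]
  -- the local sections of `r`
  let σ : (h : G) → G → G := fun h g =>
    if hx : r g ∈ Set.range ((S h).domRestrict (r : G → G)) then hx.choose.1 else g
  have σ_spec : ∀ h k, k ∈ S h → ∀ g, r k = r g → σ h g = k := by
    intro h k hk g e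
    have hx : r g ∈ Set.range ((S h).domRestrict (r : G → G)) := ⟨⟨k, hk⟩, e⟩
    have h1 : (S h).domRestrict (r : G → G) hx.choose = (S h).domRestrict (r : G → G) ⟨k, hk⟩ :=
      hx.choose_spec.trans e.symm
    have h2 := (hS h).2.1.injective h1
    simp only [σ, hx, dif_pos, h2]
  have σ_mem : ∀ h g, r g ∈ Set.range ((S h).domRestrict (r : G → G)) →
      σ h g ∈ S h ∧ r (σ h g) = r g := by
    rintro h g ⟨k, hk⟩
    have hk' : r k.1 = r g := hk
    rw [σ_spec h k k.2 g hk']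
    exact ⟨k.2, hk'⟩
  have hV1 : ∀ h ∈ F, ∀ᶠ g in nhds g₀, r g ∈ Set.range ((S h).domRestrict (r : G → G)) := by
    intro h hh
    refine continuous_r.continuousAt.eventually
      ((hS h).2.1.isOpen_range.mem_nhds ⟨⟨h, hmem h⟩, ((memF h).1 hh).1⟩)
  have σ_cont : ∀ h ∈ F, ContinuousAt (σ h) g₀ := by
    intro h hh
    have e0 : σ h g₀ = h := σ_spec h h (hmem h) g₀ ((memF h).1 hh).1
    rw [ContinuousAt, e0, tendsto_nhds]
    intro W hW hhW
    have hop : IsOpen ((S h).domRestrict (r : G → G) '' (Subtype.val ⁻¹' W)) :=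
      (hS h).2.1.isOpenMap _ (hW.preimage continuous_subtype_val)
    have hg₀ : r g₀ ∈ (S h).domRestrict (r : G → G) '' (Subtype.val ⁻¹' W) :=
      ⟨⟨h, hmem h⟩, hhW, ((memF h).1 hh).1⟩
    filter_upwards [continuous_r.continuousAt.eventually (hop.mem_nhds hg₀)] with g hg
    obtain ⟨k, hkW, hk⟩ := hg
    have hk' : r k.1 = r g := hk
    simp only [Set.mem_preimage]
    rw [σ_spec h k k.2 g hk']
    exact hkW
  have hC : IsCompact (tsupport f \ ⋃ h ∈ F, S h) :=
    hf'.isCompact.diff (isOpen_biUnion fun h _ => (hS h).1)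
  have hV2 : ∀ᶠ g in nhds g₀, r g ∉ r '' (tsupport f \ ⋃ h ∈ F, S h) := by
    refine continuous_r.continuousAt.eventually
      ((hC.image continuous_r).isClosed.isOpen_compl.mem_nhds ?_)
    rintro ⟨k, ⟨hk1, hk2⟩, hk3⟩
    exact hk2 (Set.mem_iUnion₂.2 ⟨k, (memF k).2 ⟨hk3, hk1⟩, hmem k⟩)
  have hEq : (fun g => ∑ᶠ h ∈ {h : G | r h = r g}, f h * Φ h g) =ᶠ[nhds g₀]
      fun g => ∑ h ∈ F, f (σ h g) * Φ (σ h g) g := by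
    filter_upwards [hV2, (Filter.eventually_all_finset F).2 hV1] with g hg1 hg2
    have hinj : Set.InjOn (fun h => σ h g) F := by
      intro a ha b hb e
      by_contra hne
      have h1 := hsub a (σ_mem a g (hg2 a ha)).1
      have h2 := hsub b (σ_mem b g (hg2 b hb)).1
      simp only at e
      rw [← e] at h2
      exact Set.disjoint_left.1 (hdisj ((memF a).1 ha) ((memF b).1 hb) hne) h1 h2
    rw [← Finset.sum_image (f := fun k => f k * Φ k g) hinj]
    refine finsum_mem_eq_sum_of_inter_support_eq _ ?_
    ext k
    simp only [Set.mem_inter_iff, Function.mem_support, Finset.mem_coe]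
    constructor
    · rintro ⟨hk1, hk2⟩
      refine ⟨?_, hk2⟩
      have hk3 : k ∈ tsupport f := subset_tsupport f (left_ne_zero_of_mul hk2)
      have hk4 : k ∈ ⋃ h ∈ F, S h := by
        by_contra hk4
        exact hg1 ⟨k, ⟨hk3, hk4⟩, hk1⟩
      obtain ⟨h, hh, hk5⟩ := Set.mem_iUnion₂.1 hk4
      exact Finset.mem_image.2 ⟨h, hh, σ_spec h k hk5 g hk1⟩
    · rintro ⟨hk1, hk2⟩
      obtain ⟨h, hh, rfl⟩ := Finset.mem_image.1 hk1
      exact ⟨(σ_mem h g (hg2 h hh)).2, hk2⟩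
  refine ContinuousAt.congr ?_ hEq.symm
  refine tendsto_finsetSum F fun h hh => ?_
  refine Filter.Tendsto.mul (hf.continuousAt.comp (σ_cont h hh)) ?_
  have e0 : σ h g₀ = h := σ_spec h h (hmem h) g₀ ((memF h).1 hh).1
  have hmemp : (σ h g₀, g₀) ∈ {p : G × G | r p.1 = r p.2} := by
    simp only [Set.mem_ofPred_eq, e0]
    exact ((memF h).1 hh).1
  refine Filter.Tendsto.comp (g := fun p : G × G => Φ p.1 p.2) (f := fun g => (σ h g, g))
    (hΦ _ hmemp).tendsto (tendsto_nhdsWithin_iff.2 ⟨?_, ?_⟩)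
  · exact (σ_cont h hh).prodMk continuousAt_id
  · filter_upwards [hV1 h hh] with g hg
    exact (σ_mem h g hg).2

namespace ConvAlgebra

theorem finiteOnFibers (f : ConvAlgebra G) : FiniteOnFibers (f : G → ℂ) := fun x =>
  (finite_fiber f.hasCompactSupport.isCompact x).subset fun _ hh =>
    ⟨hh.1, subset_tsupport _ hh.2⟩

theorem continuous_conv (f₁ f₂ : ConvAlgebra G) : Continuous (conv (f₁ : G → ℂ) f₂) := by
  refine continuous_fiber_sum f₁.continuous f₁.hasCompactSupport (Φ := fun h g => f₂ (h⁻¹ * g)) ?_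
  refine f₂.continuous.comp_continuousOn ?_
  have h1 : Continuous fun p : G × G => (p.1⁻¹, p.2) :=
    (IsEtale.continuous_inv.comp continuous_fst).prodMk continuous_snd
  refine IsEtale.continuousOn_mul.comp h1.continuousOn ?_
  intro p hp
  exact composable_iff.2 (by rw [d_inv]; exact hp)

theorem hasCompactSupport_conv (f₁ f₂ : ConvAlgebra G) :
    HasCompactSupport (conv (f₁ : G → ℂ) f₂) := by
  have hcl : IsClosed {p : G × G | d p.1 = r p.2} :=
    isClosed_eq (continuous_d.comp continuous_fst) (continuous_r.comp continuous_snd)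
  have hK := (f₁.hasCompactSupport.isCompact.prod f₂.hasCompactSupport.isCompact).inter_right hcl
  have hm : ContinuousOn (fun p : G × G => p.1 * p.2)
      ((tsupport f₁ ×ˢ tsupport f₂) ∩ {p : G × G | d p.1 = r p.2}) :=
    IsEtale.continuousOn_mul.mono fun p hp => composable_iff.2 hp.2
  refine HasCompactSupport.intro (hK.image_of_continuousOn hm) fun g hg => ?_
  refine finsum_mem_eq_zero_of_forall_eq_zero fun h hh => ?_
  by_contra hne
  refine hg ⟨(h, h⁻¹ * g), ⟨⟨subset_tsupport _ (left_ne_zero_of_mul hne),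
    subset_tsupport _ (right_ne_zero_of_mul hne)⟩, ?_⟩, mul_inv_cancel_left' hh⟩
  exact (r_inv_mul hh).symm

noncomputable instance : Mul (ConvAlgebra G) where
  mul f₁ f₂ := ⟨⟨conv (f₁ : G → ℂ) f₂, continuous_conv f₁ f₂⟩, hasCompactSupport_conv f₁ f₂⟩

theorem coe_mul (f₁ f₂ : ConvAlgebra G) : ⇑(f₁ * f₂) = conv (f₁ : G → ℂ) f₂ := rfl

theorem mul_apply (f₁ f₂ : ConvAlgebra G) (g : G) :
    (f₁ * f₂) g = ∑ᶠ h ∈ {h : G | r h = r g}, f₁ h * f₂ (h⁻¹ * g) := rfl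

noncomputable instance : Star (ConvAlgebra G) where
  star f := ⟨⟨invol f, Complex.continuous_conj.comp (f.continuous.comp IsEtale.continuous_inv)⟩, by
    refine HasCompactSupport.intro (f.hasCompactSupport.isCompact.image IsEtale.continuous_inv)
      fun g hg => ?_
    have : f g⁻¹ = 0 := by
      by_contra hne
      exact hg ⟨g⁻¹, subset_tsupport _ hne, inv_inv' g⟩
    simp [invol, this]⟩

theorem coe_star (f : ConvAlgebra G) : ⇑(star f) = invol (f : G → ℂ) := rfl

theorem star_apply (f : ConvAlgebra G) (g : G) : star f g = (starRingEnd ℂ) (f g⁻¹) := rfl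

noncomputable instance : NonUnitalRing (ConvAlgebra G) where
  left_distrib f g h := ext <| by
    simp only [coe_mul, coe_add, conv_add_right f.finiteOnFibers]
  right_distrib f g h := ext <| by
    simp only [coe_mul, coe_add, conv_add_left f.finiteOnFibers g.finiteOnFibers]
  zero_mul f := ext <| by
    funext g
    simp [coe_mul, coe_zero, conv]
  mul_zero f := ext <| by
    funext g
    simp [coe_mul, coe_zero, conv]
  mul_assoc f g h := ext <| by
    simp only [coe_mul, conv_assoc f.finiteOnFibers g.finiteOnFibers]

noncomputable instance : StarRing (ConvAlgebra G) where
  star_involutive f := ext <| by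
    funext g
    simp [star_apply, inv_inv']
  star_mul f g := ext <| by
    simp only [coe_mul, coe_star, conv_invol _ _ f.finiteOnFibers]
  star_add f g := ext <| by
    funext x
    simp [star_apply, coe_add]

instance : StarModule ℂ (ConvAlgebra G) where
  star_smul c f := ext <| by
    funext x
    simp [star_apply, coe_smul]

instance : IsScalarTower ℂ (ConvAlgebra G) (ConvAlgebra G) where
  smul_assoc c f g := ext <| by
    simp only [smul_eq_mul, coe_mul, coe_smul, conv_smul_left]

instance : SMulCommClass ℂ (ConvAlgebra G) (ConvAlgebra G) where
  smul_comm c f g := ext <| by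
    simp only [smul_eq_mul, coe_mul, coe_smul, conv_smul_right]

end ConvAlgebra

end Topology

section Representation

variable {G : Type u} [TopologicalSpace G] [Groupoid G]

/-- The Hilbert space `ℓ²(G_u)`, where `G_u` is the set of arrows with domain `u`. -/
abbrev L2 (u : G) : Type u := lp (fun _ : {g : G // d g = u} => ℂ) 2

variable [IsEtale G]

theorem exists_sum_norm_le (f : ConvAlgebra G) : ∃ C : ℝ, 0 ≤ C ∧
    (∀ (x : G) (s : Finset G), (∀ h ∈ s, r h = x) → ∑ h ∈ s, ‖f h‖ ≤ C) ∧
    (∀ (x : G) (s : Finset G), (∀ h ∈ s, d h = x) → ∑ h ∈ s, ‖f h‖ ≤ C) := by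
  classical
  obtain ⟨B, hB⟩ := f.hasCompactSupport.exists_bound_of_continuous f.continuous
  obtain ⟨n, hn⟩ := exists_card_le f.hasCompactSupport.isCompact
  obtain ⟨m, hm⟩ := exists_card_le' f.hasCompactSupport.isCompact
  have hB' : ∀ h, ‖f h‖ ≤ max B 0 := fun h => (hB h).trans (le_max_left _ _)
  have hB0 : 0 ≤ max B 0 := le_max_right _ _
  have key : ∀ s : Finset G, ∑ h ∈ s, ‖f h‖ ≤ (s.filter fun h => f h ≠ 0).card * max B 0 := by
    intro s
    have : ∑ h ∈ s, ‖f h‖ = ∑ h ∈ s.filter (fun h => f h ≠ 0), ‖f h‖ := by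
      refine (Finset.sum_filter_of_ne fun h _ hne => ?_).symm
      simpa using hne
    rw [this, ← nsmul_eq_mul]
    exact Finset.sum_le_card_nsmul _ _ _ fun h _ => hB' h
  refine ⟨(max n m : ℕ) * max B 0, by positivity, fun x s hs => ?_, fun x s hs => ?_⟩
  · refine (key s).trans (mul_le_mul_of_nonneg_right ?_ hB0)
    refine Nat.cast_le.2 (le_trans (hn x _ fun h hh => ⟨subset_tsupport _ (Finset.mem_filter.1 hh).2,
      hs h (Finset.mem_filter.1 hh).1⟩) (le_max_left _ _))
  · refine (key s).trans (mul_le_mul_of_nonneg_right ?_ hB0)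
    refine Nat.cast_le.2 (le_trans (hm x _ fun h hh => ⟨subset_tsupport _ (Finset.mem_filter.1 hh).2,
      hs h (Finset.mem_filter.1 hh).1⟩) (le_max_right _ _))

theorem finite_kernel (f : ConvAlgebra G) {u : G} (g : {g : G // d g = u}) :
    {k : {g : G // d g = u} | f (g.1 * k.1⁻¹) ≠ 0}.Finite := by
  refine Set.Finite.of_finite_image ((f.finiteOnFibers (r g.1)).subset ?_)
    (f := fun k : {g : G // d g = u} => g.1 * k.1⁻¹) ?_
  · rintro _ ⟨k, hk, rfl⟩
    exact ⟨r_mul_inv (g.2.trans k.2.symm), hk⟩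
  · intro a _ b _ e
    exact Subtype.ext (mul_inv_injective (g.2.trans a.2.symm) (g.2.trans b.2.symm) e)

theorem sum_conv_sq_le (f : ConvAlgebra G) {C : ℝ} (hC : 0 ≤ C)
    (h₁ : ∀ (x : G) (s : Finset G), (∀ h ∈ s, r h = x) → ∑ h ∈ s, ‖f h‖ ≤ C)
    (h₂ : ∀ (x : G) (s : Finset G), (∀ h ∈ s, d h = x) → ∑ h ∈ s, ‖f h‖ ≤ C)
    {u : G} (ξ : L2 u) (s : Finset {g : G // d g = u}) :
    ∑ g ∈ s, ‖conv f (extendZero ξ) g.1‖ ^ (2 : ℝ≥0∞).toReal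
      ≤ (C * ‖ξ‖) ^ (2 : ℝ≥0∞).toReal := by
  classical
  set T := s.biUnion fun g => (finite_kernel f g).toFinset with hTdef
  have hT : ∀ g ∈ s, ∀ k : {g : G // d g = u}, f (g.1 * k.1⁻¹) ≠ 0 → k ∈ T := by
    intro g hg k hk
    exact Finset.mem_biUnion.2 ⟨g, hg, by simpa using hk⟩
  have row : ∀ g : {g : G // d g = u}, ∑ k ∈ T, ‖f (g.1 * k.1⁻¹)‖ ≤ C := by
    intro g
    rw [← Finset.sum_image (f := fun h => ‖f h‖) (g := fun k : {g : G // d g = u} => g.1 * k.1⁻¹)]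
    · refine h₁ (r g.1) _ fun h hh => ?_
      obtain ⟨k, -, rfl⟩ := Finset.mem_image.1 hh
      exact r_mul_inv (g.2.trans k.2.symm)
    · intro a _ b _ e
      exact Subtype.ext (mul_inv_injective (g.2.trans a.2.symm) (g.2.trans b.2.symm) e)
  have col : ∀ k : {g : G // d g = u}, ∑ g ∈ s, ‖f (g.1 * k.1⁻¹)‖ ≤ C := by
    intro k
    rw [← Finset.sum_image (f := fun h => ‖f h‖) (g := fun g : {g : G // d g = u} => g.1 * k.1⁻¹)]
    · refine h₂ (r k.1) _ fun h hh => ?_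
      obtain ⟨g, -, rfl⟩ := Finset.mem_image.1 hh
      exact d_mul_inv (g.2.trans k.2.symm)
    · intro a _ b _ e
      have e' : a.1 * k.1⁻¹ = b.1 * k.1⁻¹ := e
      refine Subtype.ext ?_
      rw [← inv_mul_cancel_right' (a.2.trans k.2.symm), e',
        inv_mul_cancel_right' (b.2.trans k.2.symm)]
  simp only [ENNReal.toReal_ofNat, Real.rpow_ofNat]
  have hξ : ∑ k ∈ T, ‖ξ k‖ ^ 2 ≤ ‖ξ‖ ^ 2 := by
    have := lp.sum_rpow_le_norm_rpow (p := 2) (by simp) ξ T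
    simpa only [ENNReal.toReal_ofNat, Real.rpow_ofNat] using this
  calc ∑ g ∈ s, ‖conv f (extendZero ξ) g.1‖ ^ 2
      ≤ ∑ g ∈ s, C * ∑ k ∈ T, ‖f (g.1 * k.1⁻¹)‖ * ‖ξ k‖ ^ 2 := by
        refine Finset.sum_le_sum fun g hg => ?_
        rw [conv_extendZero f ξ g T (hT g hg)]
        have t1 : ‖∑ k ∈ T, f (g.1 * k.1⁻¹) * ξ k‖ ≤ ∑ k ∈ T, ‖f (g.1 * k.1⁻¹)‖ * ‖ξ k‖ :=
          (norm_sum_le _ _).trans (by simp)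
        have t2 : (∑ k ∈ T, ‖f (g.1 * k.1⁻¹)‖ * ‖ξ k‖) ^ 2 ≤
            (∑ k ∈ T, ‖f (g.1 * k.1⁻¹)‖) * ∑ k ∈ T, ‖f (g.1 * k.1⁻¹)‖ * ‖ξ k‖ ^ 2 :=
          Finset.sum_sq_le_sum_mul_sum_of_sq_le_mul T (fun _ _ => by positivity)
            (fun _ _ => by positivity) fun _ _ => le_of_eq (by ring)
        calc _ ≤ (∑ k ∈ T, ‖f (g.1 * k.1⁻¹)‖ * ‖ξ k‖) ^ 2 := by gcongr
          _ ≤ _ := t2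
          _ ≤ _ := mul_le_mul_of_nonneg_right (row g)
            (Finset.sum_nonneg fun _ _ => by positivity)
    _ = C * ∑ k ∈ T, (∑ g ∈ s, ‖f (g.1 * k.1⁻¹)‖) * ‖ξ k‖ ^ 2 := by
        rw [← Finset.mul_sum, Finset.sum_comm]
        simp only [Finset.sum_mul]
    _ ≤ C * ∑ k ∈ T, C * ‖ξ k‖ ^ 2 := by
        gcongr with k _
        exact col k
    _ = C ^ 2 * ∑ k ∈ T, ‖ξ k‖ ^ 2 := by rw [← Finset.mul_sum]; ring
    _ ≤ C ^ 2 * ‖ξ‖ ^ 2 := by gcongr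
    _ = (C * ‖ξ‖) ^ 2 := by ring

/-- The operator `ξ ↦ f * ξ` on `ℓ²(G_u)`. -/
noncomputable def regRepOp (u : G) (f : ConvAlgebra G) : L2 u →L[ℂ] L2 u :=
  LinearMap.mkContinuousOfExistsBound
    { toFun := fun ξ => ⟨fun g => conv f (extendZero ξ) g.1, by
        obtain ⟨C, hC, h₁, h₂⟩ := exists_sum_norm_le f
        exact memℓp_gen' (sum_conv_sq_le f hC h₁ h₂ ξ)⟩
      map_add' := fun ξ η => by
        ext g
        have : extendZero (⇑(ξ + η)) = extendZero ξ + extendZero η := by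
          funext x
          by_cases hx : d x = u <;> simp [extendZero, hx]
        exact congrFun ((congrArg (conv f) this).trans (conv_add_right f.finiteOnFibers _ _)) g.1
      map_smul' := fun c ξ => by
        ext g
        have : extendZero (⇑(c • ξ)) = c • extendZero ξ := by
          funext x
          by_cases hx : d x = u <;> simp [extendZero, hx]
        exact congrFun ((congrArg (conv f) this).trans (conv_smul_right _ _ _)) g.1 }
    (by
      obtain ⟨C, hC, h₁, h₂⟩ := exists_sum_norm_le f
      refine ⟨C, fun ξ => ?_⟩
      exact lp.norm_le_of_forall_sum_le (by simp) (by positivity) (sum_conv_sq_le f hC h₁ h₂ ξ))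

theorem regRepOp_apply (u : G) (f : ConvAlgebra G) (ξ : L2 u) (g : {g : G // d g = u}) :
    regRepOp u f ξ g = conv f (extendZero ξ) g.1 := rfl

theorem exists_norm_regRepOp_le (f : ConvAlgebra G) : ∃ C : ℝ, ∀ u : G, ‖regRepOp u f‖ ≤ C := by
  obtain ⟨C, hC, h₁, h₂⟩ := exists_sum_norm_le f
  refine ⟨C, fun u => ContinuousLinearMap.opNorm_le_bound _ hC fun ξ => ?_⟩
  exact lp.norm_le_of_forall_sum_le (by simp) (by positivity) (sum_conv_sq_le f hC h₁ h₂ ξ)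

theorem extendZero_regRepOp (u : G) (f : ConvAlgebra G) (ξ : L2 u) :
    extendZero (regRepOp u f ξ) = conv f (extendZero ξ) := by
  funext g
  by_cases hg : d g = u
  · simp [extendZero, hg, regRepOp_apply]
  · simp only [extendZero, hg, dif_neg, not_false_eq_true]
    refine (finsum_mem_eq_zero_of_forall_eq_zero fun h hh => ?_).symm
    have : d (h⁻¹ * g) ≠ u := by rwa [d_inv_mul hh]
    simp only [extendZero, this, dif_neg, not_false_eq_true, mul_zero]

theorem regRepOp_star (u : G) (f : ConvAlgebra G) :
    regRepOp u (star f) = star (regRepOp u f) := by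
  classical
  ext η g
  have h1 : star (regRepOp u f) η g
      = inner ℂ (regRepOp u f (lp.single 2 g (1 : ℂ))) η := by
    rw [ContinuousLinearMap.star_eq_adjoint, ← ContinuousLinearMap.adjoint_inner_right,
      lp.inner_single_left]
    simp
  have h2 : ∀ k : {g : G // d g = u},
      regRepOp u f (lp.single 2 g (1 : ℂ)) k = f (k.1 * g.1⁻¹) := by
    intro k
    rw [regRepOp_apply, conv_extendZero f _ k (insert g (finite_kernel f k).toFinset)
      (fun x hx => by simp [hx]), Finset.sum_eq_single g]
    · simp
    · intro b _ hb
      simp [lp.single_apply, hb]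
    · simp
  have h3 : ∀ k : {g : G // d g = u}, (g.1 * k.1⁻¹)⁻¹ = k.1 * g.1⁻¹ := by
    intro k
    rw [mul_inv_rev' (by rw [r_inv, g.2, k.2]), inv_inv']
  rw [h1, lp.inner_eq_tsum, regRepOp_apply,
    conv_extendZero (⇑(star f)) _ g (finite_kernel (star f) g).toFinset (by simp),
    tsum_eq_sum (s := (finite_kernel (star f) g).toFinset)]
  · refine Finset.sum_congr rfl fun k _ => ?_
    rw [h2, ConvAlgebra.star_apply, h3]
    simp [mul_comm]
  · intro k hk
    have : f (k.1 * g.1⁻¹) = 0 := by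
      simpa [ConvAlgebra.star_apply, h3] using hk
    rw [h2, this]
    simp

/-- The regular representation `π_u : C_c(G) → B(ℓ²(G_u))`, `π_u(f) ξ = f * ξ`. -/
noncomputable def regRep (u : G) : ConvAlgebra G →⋆ₙₐ[ℂ] (L2 u →L[ℂ] L2 u) where
  toFun := regRepOp u
  map_smul' c f := by
    ext ξ g
    simp [regRepOp_apply, ConvAlgebra.coe_smul, conv_smul_left]
  map_zero' := by
    ext ξ g
    simp [regRepOp_apply, ConvAlgebra.coe_zero, conv]
  map_add' f₁ f₂ := by
    ext ξ g
    simp [regRepOp_apply, ConvAlgebra.coe_add, conv_add_left f₁.finiteOnFibers f₂.finiteOnFibers]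
  map_mul' f₁ f₂ := by
    ext ξ g
    rw [regRepOp_apply, ConvAlgebra.coe_mul, conv_assoc f₁.finiteOnFibers f₂.finiteOnFibers,
      mul_apply_eq_comp, regRepOp_apply, extendZero_regRepOp]
  map_star' := regRepOp_star u

/-- The reduced norm `‖f‖_r = sup_{u ∈ G⁰} ‖π_u(f)‖`. -/
noncomputable def reducedNorm (f : ConvAlgebra G) : ℝ := ⨆ u : units G, ‖regRep u.1 f‖

variable (G) in
/-- The C*-algebra of all bounded families of operators `T_u ∈ B(ℓ²(G_u))`, `u ∈ G⁰`, with the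
pointwise operations and the norm `sup_u ‖T_u‖`. -/
def BoundedFamilies : Type u := lp (fun u : units G => L2 u.1 →L[ℂ] L2 u.1) ∞

noncomputable instance : NonUnitalCStarAlgebra (BoundedFamilies G) :=
  inferInstanceAs (NonUnitalCStarAlgebra (lp (fun u : units G => L2 u.1 →L[ℂ] L2 u.1) ∞))

instance : CoeFun (BoundedFamilies G) fun _ => ∀ u : units G, L2 u.1 →L[ℂ] L2 u.1 where
  coe T := T.1

theorem norm_boundedFamilies (T : BoundedFamilies G) : ‖T‖ = ⨆ u : units G, ‖T u‖ :=
  lp.norm_eq_ciSup (E := fun u : units G => L2 u.1 →L[ℂ] L2 u.1) T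

variable (G) in
/-- The `*`-homomorphism `f ↦ (π_u(f))_{u ∈ G⁰}`. -/
noncomputable def regRepFamily : ConvAlgebra G →⋆ₙₐ[ℂ] BoundedFamilies G where
  toFun f := ⟨fun u => regRep u.1 f, memℓp_infty (by
    obtain ⟨C, hC⟩ := exists_norm_regRepOp_le f
    exact ⟨C, by rintro _ ⟨u, rfl⟩; exact hC u.1⟩)⟩
  map_smul' c f := Subtype.ext (funext fun u => map_smul (regRep u.1) c f)
  map_zero' := Subtype.ext (funext fun u => map_zero (regRep u.1))
  map_add' f₁ f₂ := Subtype.ext (funext fun u => map_add (regRep u.1) f₁ f₂)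
  map_mul' f₁ f₂ := Subtype.ext (funext fun u => map_mul (regRep u.1) f₁ f₂)
  map_star' f := Subtype.ext (funext fun u => map_star (regRep u.1) f)

/-- The norm that `C_c(G)` inherits from its image is the reduced norm. -/
theorem norm_regRepFamily (f : ConvAlgebra G) : ‖regRepFamily G f‖ = reducedNorm f :=
  norm_boundedFamilies _

variable (G) in
/-- The reduced C*-algebra `C_r^*(G)`: the completion of `C_c(G)` with respect to `‖·‖_r`, realized
as the closure of the (isometric) image of `C_c(G)` in the complete space of bounded families
`(T_u)_{u ∈ G⁰}`. -/
noncomputable def ReducedCStarAlgebra : NonUnitalStarSubalgebra ℂ (BoundedFamilies G) :=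
  (NonUnitalStarAlgHom.range (regRepFamily G)).topologicalClosure

noncomputable instance : NonUnitalCStarAlgebra (ReducedCStarAlgebra G) :=
  NonUnitalStarSubalgebra.nonUnitalCStarAlgebra _
    (h_closed := NonUnitalStarSubalgebra.isClosed_topologicalClosure _)

end Representation

/-- A C*-algebra is simple if it is nonzero and its only closed two-sided ideals are `0` and the
whole algebra. -/
def IsSimpleCStarAlgebra (A : Type*) [NonUnitalCStarAlgebra A] : Prop :=
  Nontrivial A ∧ ∀ I : Submodule ℂ A, IsClosed (I : Set A) →
    (∀ a : A, ∀ x ∈ I, a * x ∈ I ∧ x * a ∈ I) → I = ⊥ ∨ I = ⊤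

end Gpd

/-! Elements of `ReducedCStarAlgebra G` behave like functions on `G`. The coefficient of `a` at a
pair `(g, k)` depends only on `k * g⁻¹` (`matrixCoeff_eq_coeff`): this is visible on `C_c(G)` and
passes to limits. So `a` is determined by the function `coeff a`, which is continuous as a uniform
limit of functions in `C_c(G)`.

Minimal implies simple. Minimality makes every orbit of units dense (`IsMinimal.exists_arrow`), and
trivial isotropy spreads along the orbit of `u`. For `a ≠ 0` in a closed ideal there is therefore a
unit `v` of trivial isotropy at which `b = star a * a` has nonzero coefficient `c`. Near `v` no
arrow of a given compact set of non-units has both ends close to `v`, so compressing by a bump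
function `h` at `v` leaves approximately `c • (h * h)` (`exists_compression`). The ideal thus
contains an element at distance less than `1` from `h * h`, and so every function whose arrows have
range in an open set where `h = 1` (`mem_of_mul_eq_self`). Density of orbits is used again to carry
such functions along bisections to all units: finite sums of elements `star q * q` give positive
functions on units, and dividing by them puts all of `C_c(G)` in the ideal.

Simple implies minimal. A closed invariant set `D` defines the closed ideal of elements vanishing
over `D`. A bump function at a unit outside `D` lies in it, while a bump function at a unit of `D`
does not. So the ideal can be `⊥` or `⊤` only if `D` is everything or empty. -/

namespace Gpd

/-! ### Units, and convolution by functions supported on them. -/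

section Units

variable {G : Type u} [Groupoid G]

theorem r_mem_units (g : G) : r g ∈ units G := ⟨g, rfl⟩

theorem d_mem_units (g : G) : d g ∈ units G := by
  rw [← r_inv]
  exact r_mem_units _

theorem r_eq_self {u : G} (hu : u ∈ units G) : r u = u := mem_units_iff.1 hu

theorem inv_eq_self {u : G} (hu : u ∈ units G) : u⁻¹ = u := by
  obtain ⟨g, rfl⟩ := hu
  rw [mul_inv_rev' (by rw [r_inv]), inv_inv']

theorem d_eq_self {u : G} (hu : u ∈ units G) : d u = u := by
  rw [← r_inv, inv_eq_self hu, r_eq_self hu]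

theorem inv_mul_mem_units {h g : G} (hr : r h = r g) (H : h⁻¹ * g ∈ units G) : h = g := by
  have h1 : h⁻¹ * g = d h := by rw [← r_inv_mul hr, r_eq_self H]
  rw [← mul_inv_cancel_left' hr, h1, mul_d_self]

theorem eq_units_of_mul_self {h x : G} (hd : d h = r x) (H : h * x = h) : x ∈ units G := by
  have h1 := inv_mul_cancel_left' hd
  rw [H] at h1
  rw [← h1]
  exact d_mem_units h

/-- The only unit in the fibre of `r` over `r g` is `r g` itself, so the sum has one term. Functions
on units thus act as multiplication operators, which all later computations with bump functions rely
on. -/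
theorem conv_unitSupported_left {p : G → ℂ} (hp : ∀ x, p x ≠ 0 → x ∈ units G) (ξ : G → ℂ) (g : G) :
    conv p ξ g = p (r g) * ξ g := by
  rw [conv_eq_sum p ξ g {r g}]
  · rw [Finset.sum_singleton, inv_eq_self (r_mem_units g), r_mul_self]
  · intro h hh
    rw [Finset.mem_singleton.1 hh, r_eq_self (r_mem_units g)]
  · intro h hh hne
    rw [Finset.mem_singleton, ← hh, r_eq_self (hp h hne)]

theorem conv_unitSupported_right {p : G → ℂ} (hp : ∀ x, p x ≠ 0 → x ∈ units G) (f : G → ℂ) (g : G) :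
    conv f p g = f g * p (d g) := by
  rw [conv, finsum_mem_eq_sum_of_inter_support_eq (t := {g}), Finset.sum_singleton]
  · rfl
  · ext h
    simp only [Set.mem_inter_iff, Set.mem_ofPred_eq, Function.mem_support, Finset.coe_singleton,
      Set.mem_singleton_iff]
    constructor
    · rintro ⟨h1, h2⟩
      exact ⟨inv_mul_mem_units h1 (hp _ (right_ne_zero_of_mul h2)), h2⟩
    · rintro ⟨rfl, h2⟩
      exact ⟨rfl, h2⟩

end Units

/-! ### Openness of `r` and `d`, density of orbits, bump functions. -/

section TopologicalLemmas

variable {G : Type u} [TopologicalSpace G] [Groupoid G] [IsEtale G]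

theorem isOpenMap_r : IsOpenMap (r : G → G) := by
  rw [IsEtale.isTopologicalBasis.isOpenMap_iff]
  rintro S ⟨-, hS, -⟩
  have := hS.isOpen_range
  rwa [Set.range_domRestrict] at this

theorem isOpenMap_d : IsOpenMap (d : G → G) := by
  rw [IsEtale.isTopologicalBasis.isOpenMap_iff]
  rintro S ⟨-, -, hS⟩
  have := hS.isOpen_range
  rwa [Set.range_domRestrict] at this

variable (G) in
theorem isOpen_units : IsOpen (units G) := by
  have : units G = Set.range (r : G → G) := by
    ext u
    exact ⟨fun ⟨g, hg⟩ => ⟨g, hg.symm⟩, fun ⟨g, hg⟩ => ⟨g, hg.symm⟩⟩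
  rw [this]
  exact isOpenMap_r.isOpen_range

/-- Minimality means that every orbit is dense. The units whose orbit misses `U` form an invariant
set, closed because `d` is an open map; a unit lying in `U` shows that it is not everything. -/
theorem IsMinimal.exists_arrow (hG : IsMinimal G) {U : Set G} (hU : IsOpen U)
    (hne : (U ∩ units G).Nonempty) {w : G} (hw : w ∈ units G) : ∃ g : G, d g = w ∧ r g ∈ U := by
  let D : Set (units G) := {w | ¬ ∃ g : G, d g = w.1 ∧ r g ∈ U}
  have hcl : IsClosed D := by
    refine ⟨?_⟩
    have : Dᶜ = Subtype.val ⁻¹' (d '' (r ⁻¹' U)) := by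
      ext w
      simp only [D, Set.mem_compl_iff, Set.mem_ofPred_eq, not_not, Set.mem_preimage, Set.mem_image]
      exact exists_congr fun g => and_comm
    rw [this]
    exact (isOpenMap_d _ (hU.preimage continuous_r)).preimage continuous_subtype_val
  have hinv : IsInvariant D := by
    rintro g ⟨w, hw, hwg⟩
    refine ⟨⟨r g, r_mem_units g⟩, ?_, rfl⟩
    rintro ⟨k, hk, hkU⟩
    exact hw ⟨k * g, by rw [d_mul hk, hwg], by rwa [r_mul hk]⟩
  rcases hG D hcl hinv with h | h
  · by_contra hc
    have : (⟨w, hw⟩ : units G) ∈ D := hc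
    simp [h] at this
  · obtain ⟨v, hvU, hv⟩ := hne
    have : (⟨v, hv⟩ : units G) ∈ D := by simp [h]
    exact absurd ⟨v, d_eq_self hv, by rwa [r_eq_self hv]⟩ this

/-- Urysohn functions in `C_c(G)`. -/
theorem ConvAlgebra.exists_eq_one {K U : Set G} (hK : IsCompact K) (hU : IsOpen U) (hKU : K ⊆ U) :
    ∃ f : ConvAlgebra G, (∀ x ∈ K, f x = 1) ∧ (∀ x, f x ≠ 0 → x ∈ U) ∧ ∀ x, ‖f x‖ ≤ 1 := by
  obtain ⟨f, hf1, hf3, hf4, hf2⟩ := exists_continuousMap_one_of_isCompact_subset_isOpen hK hU hKU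
  refine ⟨⟨⟨fun x => (f x : ℂ), by fun_prop⟩,
    HasCompactSupport.comp_left (g := fun t : ℝ => (t : ℂ)) hf3 Complex.ofReal_zero⟩, ?_, ?_, ?_⟩
  · intro x hx
    show (f x : ℂ) = 1
    rw [hf1 hx]
    simp
  · intro x hx
    refine hf4 (subset_tsupport _ fun h0 => hx ?_)
    show (f x : ℂ) = 0
    rw [h0, Complex.ofReal_zero]
  · intro x
    show ‖(f x : ℂ)‖ ≤ 1
    have h1 := (hf2 x).1
    have h2 := (hf2 x).2
    rw [Complex.norm_real, Real.norm_of_nonneg h1]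
    exact h2

/-- Urysohn functions equal to `1` near a point. -/
theorem ConvAlgebra.exists_eventually_eq_one {x : G} {U : Set G} (hU : U ∈ nhds x) :
    ∃ f : ConvAlgebra G, (∀ᶠ y in nhds x, f y = 1) ∧ (∀ y, f y ≠ 0 → y ∈ U) ∧
      ∀ y, ‖f y‖ ≤ 1 := by
  obtain ⟨K, hK, hxK, hKU⟩ := exists_compact_subset isOpen_interior (mem_interior_iff_mem_nhds.2 hU)
  obtain ⟨f, h1, h2, h3⟩ := exists_eq_one hK isOpen_interior hKU
  refine ⟨f, ?_, fun y hy => interior_subset (h2 y hy), h3⟩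
  filter_upwards [mem_interior_iff_mem_nhds.1 hxK] with y hy using h1 y hy

end TopologicalLemmas

/-! ### Elements of the reduced algebra as continuous functions on `G`. -/

section Coefficients

variable {G : Type u} [TopologicalSpace G] [Groupoid G] [IsEtale G]

omit [TopologicalSpace G] [IsEtale G] in
theorem norm_apply_le (T : BoundedFamilies G) (w : units G) : ‖T w‖ ≤ ‖T‖ :=
  lp.norm_apply_le_norm (E := fun u : units G => L2 u.1 →L[ℂ] L2 u.1) (by simp) T w

open Classical in
/-- The matrix coefficient `⟨T_w δ_g, δ_k⟩`. -/
noncomputable def matrixCoeff (w : units G) (g k : {g : G // d g = w.1}) (T : BoundedFamilies G) : ℂ :=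
  T w (lp.single 2 g (1 : ℂ)) k

omit [TopologicalSpace G] [IsEtale G] in
theorem matrixCoeff_sub (w : units G) (g k : {g : G // d g = w.1}) (S T : BoundedFamilies G) :
    matrixCoeff w g k (S - T) = matrixCoeff w g k S - matrixCoeff w g k T := rfl

omit [TopologicalSpace G] [IsEtale G] in
theorem norm_matrixCoeff_le (w : units G) (g k : {g : G // d g = w.1}) (T : BoundedFamilies G) :
    ‖matrixCoeff w g k T‖ ≤ ‖T‖ := by
  classical
  refine (lp.norm_apply_le_norm (by simp) _ k).trans ?_
  refine (ContinuousLinearMap.le_opNorm _ _).trans ?_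
  rw [lp.norm_single (by simp), norm_one, mul_one]
  exact norm_apply_le T w

theorem continuous_matrixCoeff (w : units G) (g k : {g : G // d g = w.1}) :
    Continuous (matrixCoeff w g k) := by
  refine (LipschitzWith.of_dist_le_mul (K := 1) fun S T => ?_).continuous
  rw [dist_eq_norm, dist_eq_norm, NNReal.coe_one, one_mul, ← matrixCoeff_sub]
  exact norm_matrixCoeff_le _ _ _ _

theorem matrixCoeff_regRepFamily (w : units G) (g k : {g : G // d g = w.1}) (f : ConvAlgebra G) :
    matrixCoeff w g k (regRepFamily G f) = f (k.1 * g.1⁻¹) := by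
  classical
  show regRepOp w.1 f (lp.single 2 g (1 : ℂ)) k = _
  -- `g` is inserted because the kernel may vanish at `g`, while the sum is to be evaluated at that
  -- index.
  rw [regRepOp_apply, conv_extendZero f _ k (insert g (finite_kernel f k).toFinset)
    (fun x hx => by simp [hx]), Finset.sum_eq_single g]
  · simp
  · intro b _ hb
    simp [lp.single_apply, hb]
  · simp

omit [TopologicalSpace G] [IsEtale G] in
/-- An operator family is determined by its matrix coefficients. -/
theorem exists_matrixCoeff_ne_zero {T : BoundedFamilies G} (hT : T ≠ 0) :
    ∃ w g k, matrixCoeff w g k T ≠ 0 := by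
  classical
  by_contra! hc
  refine hT (Subtype.ext (funext fun w => ?_))
  have h1 : ∀ g, T w (lp.single 2 g (1 : ℂ)) = 0 := fun g => by
    ext k
    exact hc w g k
  show T w = 0
  ext1 ξ
  -- Finitely supported vectors are dense, so an operator that kills every basis vector is zero.
  have h2 := (lp.hasSum_single (by simp) ξ).mapL (T w)
  have h3 : ∀ g, T w (lp.single 2 g (ξ g)) = 0 := fun g => by
    have : lp.single (E := fun _ : {g : G // d g = w.1} => ℂ) 2 g (ξ g) =
        ξ g • lp.single 2 g (1 : ℂ) := by
      rw [← lp.single_smul, smul_eq_mul, mul_one]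
    rw [this, map_smul, h1, smul_zero]
  simp only [h3] at h2
  simpa using h2.unique hasSum_zero

variable (G) in
/-- The canonical map `C_c(G) → C_r^*(G)`. -/
noncomputable def toReduced (f : ConvAlgebra G) : ReducedCStarAlgebra G :=
  ⟨regRepFamily G f, NonUnitalStarSubalgebra.le_topologicalClosure _ ⟨f, rfl⟩⟩

theorem toReduced_mul (f g : ConvAlgebra G) : toReduced G (f * g) = toReduced G f * toReduced G g :=
  Subtype.ext (map_mul _ _ _)

theorem toReduced_add (f g : ConvAlgebra G) : toReduced G (f + g) = toReduced G f + toReduced G g :=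
  Subtype.ext (map_add _ _ _)

theorem toReduced_sub (f g : ConvAlgebra G) : toReduced G (f - g) = toReduced G f - toReduced G g :=
  Subtype.ext (map_sub _ _ _)

theorem toReduced_smul (c : ℂ) (f : ConvAlgebra G) : toReduced G (c • f) = c • toReduced G f :=
  Subtype.ext (map_smul _ _ _)

theorem denseRange_toReduced : DenseRange (toReduced G) := by
  intro a
  rw [Metric.mem_closure_iff]
  intro ε hε
  have ha : a.1 ∈ closure (Set.range (regRepFamily G)) := a.2
  obtain ⟨_, ⟨f, rfl⟩, hf⟩ := Metric.mem_closure_iff.1 ha ε hε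
  exact ⟨_, ⟨f, rfl⟩, hf⟩

/-- The function on `G` attached to an element of `C_r^*(G)`, extending the inclusion of
`C_c(G)`. -/
noncomputable def coeff (a : ReducedCStarAlgebra G) (x : G) : ℂ :=
  matrixCoeff ⟨d x, d_mem_units x⟩ ⟨d x, d_eq_self (d_mem_units x)⟩ ⟨x, rfl⟩ a.1

theorem continuous_coeff_left (x : G) : Continuous fun a : ReducedCStarAlgebra G => coeff a x :=
  (continuous_matrixCoeff _ _ _).comp continuous_subtype_val

theorem coeff_sub (a b : ReducedCStarAlgebra G) (x : G) : coeff (a - b) x = coeff a x - coeff b x :=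
  rfl

theorem norm_coeff_le (a : ReducedCStarAlgebra G) (x : G) : ‖coeff a x‖ ≤ ‖a‖ :=
  norm_matrixCoeff_le _ _ _ _

theorem coeff_toReduced (f : ConvAlgebra G) (x : G) : coeff (toReduced G f) x = f x := by
  refine (matrixCoeff_regRepFamily _ _ _ f).trans ?_
  simp only [inv_eq_self (d_mem_units x), mul_d_self]

/-- Both sides are continuous in `a` and agree on the dense image of `C_c(G)`. Hence one function on
`G` records all matrix coefficients, and `coeff` is injective. -/
theorem matrixCoeff_eq_coeff (a : ReducedCStarAlgebra G) (w : units G) (g k : {g : G // d g = w.1}) :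
    matrixCoeff w g k a.1 = coeff a (k.1 * g.1⁻¹) := by
  refine denseRange_toReduced.induction_on a ?_ fun f => ?_
  · exact isClosed_eq ((continuous_matrixCoeff _ _ _).comp continuous_subtype_val)
      (continuous_coeff_left _)
  · rw [coeff_toReduced]
    exact matrixCoeff_regRepFamily w g k f

theorem exists_coeff_ne_zero {a : ReducedCStarAlgebra G} (ha : a ≠ 0) : ∃ x, coeff a x ≠ 0 := by
  obtain ⟨w, g, k, h⟩ := exists_matrixCoeff_ne_zero (T := a.1) fun h => ha (Subtype.ext h)
  exact ⟨_, by rwa [matrixCoeff_eq_coeff] at h⟩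

/-- The reduced norm dominates the supremum norm, so approximants from `C_c(G)` converge uniformly
to `coeff a`. -/
theorem continuous_coeff (a : ReducedCStarAlgebra G) : Continuous (coeff a) := by
  refine continuous_of_uniform_approx_of_continuous fun u hu => ?_
  obtain ⟨ε, hε, hεu⟩ := Metric.mem_uniformity_dist.1 hu
  obtain ⟨f, hf⟩ := denseRange_toReduced.exists_dist_lt a hε
  refine ⟨f, f.continuous, fun x => hεu ?_⟩
  rw [← coeff_toReduced f x, dist_eq_norm, ← coeff_sub]
  refine (norm_coeff_le _ _).trans_lt ?_
  rwa [← dist_eq_norm]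

/-- If the function of `a` does not vanish at `x`, then that of `a* a` does not vanish at `d x`. -/
theorem coeff_star_mul_self_ne_zero {a : ReducedCStarAlgebra G} {x : G} (hx : coeff a x ≠ 0) :
    coeff (star a * a) (d x) ≠ 0 := by
  classical
  set w : units G := ⟨d x, d_mem_units x⟩
  let e : {g : G // d g = w.1} := ⟨d x, d_eq_self (d_mem_units x)⟩
  have h1 : coeff (star a * a) (d x) = matrixCoeff w e e (star a * a).1 := by
    rw [matrixCoeff_eq_coeff]
    congr 1
    exact (r_eq_self (d_mem_units x)).symm
  -- The diagonal coefficient of `star a * a` at `e` is `⟨η, η⟩`, and `coeff a x` is the coordinate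
  -- of `η` at `x`.
  set η : L2 w.1 := a.1 w (lp.single 2 e (1 : ℂ)) with hη
  have h2 : matrixCoeff w e e (star a * a).1 = inner ℂ η η := by
    have h3 : matrixCoeff w e e (star a * a).1 = (ContinuousLinearMap.adjoint (a.1 w) η) e := rfl
    have h4 := ContinuousLinearMap.adjoint_inner_right (a.1 w) (lp.single 2 e (1 : ℂ)) η
    rw [lp.inner_single_left] at h4
    rw [h3, ← h4]
    simp
  rw [h1, h2, inner_self_ne_zero]
  intro h0
  apply hx
  show η ⟨x, rfl⟩ = 0
  rw [h0]
  rfl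

/-- Each fibre of `r` or `d` contains a single unit, so the row and column sums in the Schur-type
estimate `sum_conv_sq_le` are bounded by `C`. -/
theorem norm_toReduced_le {p : ConvAlgebra G} (hp : ∀ x, p x ≠ 0 → x ∈ units G) {C : ℝ}
    (hC : 0 ≤ C) (hpC : ∀ x, ‖p x‖ ≤ C) : ‖toReduced G p‖ ≤ C := by
  classical
  have h₁ : ∀ (x : G) (s : Finset G), (∀ h ∈ s, h ∈ units G → h = x) → ∑ h ∈ s, ‖p h‖ ≤ C := by
    intro x s hs
    by_cases hx : x ∈ s
    · rw [Finset.sum_eq_single_of_mem x hx]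
      · exact hpC x
      · intro h hh hne
        by_contra h0
        exact hne (hs h hh (hp h (norm_ne_zero_iff.1 h0)))
    · rw [Finset.sum_eq_zero]
      · exact hC
      · intro h hh
        by_contra h0
        exact hx (hs h hh (hp h (norm_ne_zero_iff.1 h0)) ▸ hh)
  refine lp.norm_le_of_forall_le (E := fun u : units G => L2 u.1 →L[ℂ] L2 u.1) hC fun u => ?_
  refine ContinuousLinearMap.opNorm_le_bound _ hC fun ξ => ?_
  refine lp.norm_le_of_forall_sum_le (by simp) (by positivity) (sum_conv_sq_le p hC ?_ ?_ ξ)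
  · exact fun x s hs => h₁ x s fun h hh hu => by rw [← hs h hh, r_eq_self hu]
  · exact fun x s hs => h₁ x s fun h hh hu => by rw [← hs h hh, d_eq_self hu]

end Coefficients

/-! ### Local units in closed ideals. -/

section Ideals

/-- A Neumann series argument that needs no unit in `A`. With `z = s - y`, the relation `s * q = q`
gives `q - z * q = y * q ∈ I`; iterating, `q` is congruent modulo `I` to `z ^ n` applied to `q`,
which tends to `0`. -/
theorem mem_of_mul_eq_self {A : Type*} [NonUnitalCStarAlgebra A] {I : Submodule ℂ A}
    (hI : IsClosed (I : Set A)) (hmul : ∀ a : A, ∀ x ∈ I, a * x ∈ I ∧ x * a ∈ I)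
    {s y q : A} (hy : y ∈ I) (hsy : ‖s - y‖ < 1) (hq : s * q = q) : q ∈ I := by
  set z := s - y with hz
  let t : ℕ → A := fun n => (fun x => z * x)^[n] q
  have ht : ∀ n, t (n + 1) = z * t n := fun n => Function.iterate_succ_apply' _ _ _
  have h1 : ∀ n, q - t n ∈ I := by
    intro n
    induction n with
    | zero => simp [t]
    | succ n ih =>
      have : q - t (n + 1) = y * q + z * (q - t n) := by
        rw [ht, mul_sub, hz, sub_mul s y q, hq]
        abel
      rw [this]
      exact I.add_mem (hmul q y hy).2 (hmul z _ ih).1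
  have h2 : ∀ n, ‖t n‖ ≤ ‖z‖ ^ n * ‖q‖ := by
    intro n
    induction n with
    | zero => simp [t]
    | succ n ih =>
      rw [ht, pow_succ', mul_assoc]
      exact (norm_mul_le _ _).trans (mul_le_mul_of_nonneg_left ih (norm_nonneg _))
  have h3 : Filter.Tendsto t Filter.atTop (nhds 0) := by
    refine squeeze_zero_norm h2 ?_
    simpa using (tendsto_pow_atTop_nhds_zero_of_lt_one (norm_nonneg z) hsy).mul_const ‖q‖
  have h4 : Filter.Tendsto (fun n => q - t n) Filter.atTop (nhds q) := by
    simpa using h3.const_sub q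
  exact hI.mem_of_tendsto h4 (Filter.Eventually.of_forall h1)

end Ideals

/-! ### Compression at a unit with trivial isotropy. -/

section Simplicity

variable {G : Type u} [TopologicalSpace G] [Groupoid G] [IsEtale G]

omit [TopologicalSpace G] [IsEtale G] in
-- Conjugation by `g` carries the isotropy at `r g` into the isotropy at `d g`.
theorem isotropy_r {g : G} (h : isotropy (d g) = {d g}) : isotropy (r g) = {r g} := by
  refine Set.Subset.antisymm ?_ ?_
  · rintro k ⟨hk1, hk2⟩
    have h1 : r (k * g) = r g := by rw [r_mul hk1, hk2]
    have h2 : g⁻¹ * (k * g) ∈ isotropy (d g) :=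
      ⟨by rw [d_inv_mul h1.symm, d_mul hk1], by rw [r_inv_mul h1.symm]⟩
    rw [h, Set.mem_singleton_iff] at h2
    have h3 := mul_inv_cancel_left' (g := g) (h := k * g) h1.symm
    rw [h2, mul_d_self] at h3
    rw [Set.mem_singleton_iff, ← mul_inv_cancel_right' hk1, ← h3]
    rfl
  · rintro _ rfl
    exact ⟨d_eq_self (r_mem_units g), r_eq_self (r_mem_units g)⟩

/-- Since units are open, the non-units in the support of `f` form a compact set. By trivial
isotropy its image under `(r, d)` misses `(v, v)`, hence misses some `V ×ˢ V`. If `h` lives in `V`,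
the part of `h * f * h` off the units vanishes. On units the difference is `h² (f - f v)`, small by
continuity of `f` at `v`. -/
theorem exists_compression_convAlgebra {v : G} (hv : v ∈ units G) (hiso : isotropy v = {v})
    (f : ConvAlgebra G) {ε : ℝ} (hε : 0 < ε) :
    ∃ h : ConvAlgebra G, (∀ᶠ y in nhds v, h y = 1) ∧ (∀ y, h y ≠ 0 → y ∈ units G) ∧
      (∀ y, ‖h y‖ ≤ 1) ∧ ‖toReduced G (h * f * h - f v • (h * h))‖ ≤ ε := by
  have hK : IsCompact (tsupport f \ units G) := f.hasCompactSupport.isCompact.diff (isOpen_units G)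
  have hK' : IsClosed ((fun k => (r k, d k)) '' (tsupport f \ units G)) :=
    (hK.image (continuous_r.prodMk continuous_d)).isClosed
  have hvK : (v, v) ∉ (fun k => (r k, d k)) '' (tsupport f \ units G) := by
    rintro ⟨k, ⟨-, hk⟩, hkv⟩
    obtain ⟨h1, h2⟩ := Prod.mk.inj hkv
    have h3 : k ∈ isotropy v := ⟨h2, h1⟩
    rw [hiso, Set.mem_singleton_iff] at h3
    exact hk (h3 ▸ hv)
  have hnhds := hK'.isOpen_compl.mem_nhds hvK
  rw [nhds_prod_eq, Filter.mem_prod_same_iff] at hnhds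
  obtain ⟨V, hV, hVK⟩ := hnhds
  have hf : ∀ᶠ y in nhds v, ‖f y - f v‖ < ε := by
    have := Metric.tendsto_nhds.1 (f.continuous.tendsto v) ε hε
    simpa only [dist_eq_norm] using this
  obtain ⟨h, h1, h2, h3⟩ := ConvAlgebra.exists_eventually_eq_one
    (Filter.inter_mem hV (Filter.inter_mem ((isOpen_units G).mem_nhds hv) hf))
  have hu : ∀ y, h y ≠ 0 → y ∈ units G := fun y hy => (h2 y hy).2.1
  have hval : ∀ x, (h * f * h - f v • (h * h)) x =
      h (r x) * f x * h (d x) - f v * (h (r x) * h x) := by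
    intro x
    show (h * f * h) x - f v * (h * h) x = _
    rw [ConvAlgebra.coe_mul, conv_unitSupported_right hu, ConvAlgebra.coe_mul,
      ConvAlgebra.coe_mul, conv_unitSupported_left hu, conv_unitSupported_left hu]
  have hoff : ∀ x, x ∉ units G → (h * f * h - f v • (h * h)) x = 0 := by
    intro x hx
    have e1 : h x = 0 := by
      by_contra hne
      exact hx (hu x hne)
    have e2 : h (r x) * f x * h (d x) = 0 := by
      by_contra hne
      have hr := (h2 _ (left_ne_zero_of_mul (left_ne_zero_of_mul hne))).1
      have hd := (h2 _ (right_ne_zero_of_mul hne)).1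
      exact hVK (Set.mk_mem_prod hr hd)
        ⟨x, ⟨subset_tsupport _ (right_ne_zero_of_mul (left_ne_zero_of_mul hne)), hx⟩, rfl⟩
    rw [hval, e1, e2, mul_zero, mul_zero, sub_zero]
  refine ⟨h, h1, hu, h3, norm_toReduced_le (fun x hx => ?_) hε.le fun x => ?_⟩
  · by_contra hxu
    exact hx (hoff x hxu)
  · by_cases hxu : x ∈ units G
    · rw [hval, r_eq_self hxu, d_eq_self hxu]
      by_cases hx0 : h x = 0
      · simpa [hx0] using hε.le
      · have e1 : h x * f x * h x - f v * (h x * h x) = h x * h x * (f x - f v) := by ring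
        rw [e1, norm_mul, norm_mul]
        have e2 : ‖h x‖ * ‖h x‖ ≤ 1 := mul_le_one₀ (h3 x) (norm_nonneg _) (h3 x)
        have e3 : ‖f x - f v‖ < ε := (h2 x hx0).2.2
        calc ‖h x‖ * ‖h x‖ * ‖f x - f v‖ ≤ 1 * ‖f x - f v‖ :=
              mul_le_mul_of_nonneg_right e2 (norm_nonneg _)
          _ ≤ ε := by rw [one_mul]; exact e3.le
    · rw [hoff x hxu, norm_zero]
      exact hε.le

/-- Approximation of `b` by some `f` in `C_c(G)`: the two errors caused by replacing `b`, in the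
compression and in the scalar, are each at most `‖b - F‖ < ε / 3`. -/
theorem exists_compression {v : G} (hv : v ∈ units G) (hiso : isotropy v = {v})
    (b : ReducedCStarAlgebra G) {ε : ℝ} (hε : 0 < ε) :
    ∃ h : ConvAlgebra G, (∀ᶠ y in nhds v, h y = 1) ∧ (∀ y, h y ≠ 0 → y ∈ units G) ∧
      ‖toReduced G h * b * toReduced G h - coeff b v • (toReduced G h * toReduced G h)‖ < ε := by
  obtain ⟨f, hf⟩ := denseRange_toReduced.exists_dist_lt b (show 0 < ε / 3 by positivity)
  rw [dist_eq_norm] at hf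
  obtain ⟨h, h1, h2, h3, h4⟩ := exists_compression_convAlgebra hv hiso f
    (show 0 < ε / 3 by positivity)
  refine ⟨h, h1, h2, ?_⟩
  set H := toReduced G h with hH
  have hHn : ‖H‖ ≤ 1 := norm_toReduced_le h2 zero_le_one h3
  have hHH : ‖H * H‖ ≤ 1 := (norm_mul_le _ _).trans (mul_le_one₀ hHn (norm_nonneg _) hHn)
  rw [toReduced_sub, toReduced_smul, toReduced_mul, toReduced_mul, toReduced_mul, ← hH,
    ← coeff_toReduced] at h4
  set F := toReduced G f with hF
  have e : H * b * H - coeff b v • (H * H) = H * (b - F) * H +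
      (H * F * H - coeff F v • (H * H)) - coeff (b - F) v • (H * H) := by
    rw [coeff_sub, mul_sub, sub_mul, sub_smul]
    abel
  have n1 : ‖H * (b - F) * H‖ ≤ ‖b - F‖ := by
    calc ‖H * (b - F) * H‖ ≤ ‖H‖ * ‖b - F‖ * ‖H‖ :=
          (norm_mul_le _ _).trans (mul_le_mul_of_nonneg_right (norm_mul_le _ _) (norm_nonneg _))
      _ ≤ 1 * ‖b - F‖ * 1 := by gcongr
      _ = ‖b - F‖ := by ring
  have n2 : ‖coeff (b - F) v • (H * H)‖ ≤ ‖b - F‖ := by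
    rw [norm_smul]
    calc ‖coeff (b - F) v‖ * ‖H * H‖ ≤ ‖b - F‖ * 1 := by
          gcongr
          exact norm_coeff_le _ _
      _ = ‖b - F‖ := mul_one _
  rw [e]
  refine (norm_sub_le _ _).trans_lt ?_
  have n3 := norm_add_le (H * (b - F) * H) (H * F * H - coeff F v • (H * H))
  linarith

/-! ### Minimality implies simplicity. -/

variable {I : Submodule ℂ (ReducedCStarAlgebra G)}

/-- A nonzero closed ideal contains all functions supported on `r⁻¹(W)`, for some open set `W` that
meets the units. -/
theorem exists_isOpen_forall_mem_ideal (hG : IsMinimal G) {u : G} (hu : u ∈ units G)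
    (hiso : isotropy u = {u}) (hI : IsClosed (I : Set (ReducedCStarAlgebra G)))
    (hmul : ∀ a : ReducedCStarAlgebra G, ∀ x ∈ I, a * x ∈ I ∧ x * a ∈ I) (hne : I ≠ ⊥) :
    ∃ W : Set G, IsOpen W ∧ (W ∩ units G).Nonempty ∧
      ∀ q : ConvAlgebra G, (∀ x, q x ≠ 0 → r x ∈ W) → toReduced G q ∈ I := by
  obtain ⟨a, haI, ha⟩ := I.ne_bot_iff.1 hne
  obtain ⟨x₀, hx₀⟩ := exists_coeff_ne_zero ha
  have hop : IsOpen {x | coeff a x ≠ 0} := isOpen_ne_fun (continuous_coeff a) continuous_const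
  -- The orbit of `u` meets the open set of sources of arrows where `coeff a` is nonzero; this
  -- yields such an arrow `x` whose source inherits trivial isotropy.
  obtain ⟨g, hg, x, hx, hxg⟩ := hG.exists_arrow (isOpenMap_d _ hop)
    ⟨d x₀, ⟨x₀, hx₀, rfl⟩, d_mem_units x₀⟩ hu
  have hv : isotropy (d x) = {d x} := by
    rw [hxg]
    refine isotropy_r ?_
    rw [hg, hiso]
  set v := d x with hvx
  set b := star a * a with hb
  have hbI : b ∈ I := (hmul _ _ haI).1
  have hc : coeff b v ≠ 0 := coeff_star_mul_self_ne_zero hx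
  set c := coeff b v with hcdef
  -- The tolerance is `‖c‖`, so that after division by `c` the distance to `h * h` is below `1`.
  obtain ⟨h, h1, h2, h3⟩ := exists_compression (d_mem_units x) hv b (norm_pos_iff.2 hc)
  obtain ⟨W, hW1, hW, hvW⟩ := eventually_nhds_iff.1 h1
  refine ⟨W, hW, ⟨v, hvW, d_mem_units x⟩, fun q hq => ?_⟩
  refine mem_of_mul_eq_self hI hmul (s := toReduced G h * toReduced G h)
    (y := c⁻¹ • (toReduced G h * b * toReduced G h)) ?_ ?_ ?_
  · exact I.smul_mem _ (hmul _ _ (hmul _ _ hbI).1).2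
  · have e : toReduced G h * toReduced G h - c⁻¹ • (toReduced G h * b * toReduced G h) =
        -(c⁻¹ • (toReduced G h * b * toReduced G h - c • (toReduced G h * toReduced G h))) := by
      rw [smul_sub, smul_smul, inv_mul_cancel₀ hc, one_smul, neg_sub]
    rw [e, norm_neg, norm_smul, norm_inv]
    rwa [inv_mul_lt_one₀ (norm_pos_iff.2 hc)]
  · have e : h * q = q := by
      refine ConvAlgebra.ext (funext fun y => ?_)
      rw [ConvAlgebra.coe_mul, conv_unitSupported_left h2]
      by_cases hy : q y = 0
      · rw [hy, mul_zero]
      · rw [hW1 _ (hq y hy), one_mul]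
    rw [mul_assoc, ← toReduced_mul, e, ← toReduced_mul, e]

/-- For `q` supported on a bisection, `star q * q` is `|q|²` carried to the units along `d`. This
moves positivity from the range of `k` to its source. -/
theorem exists_nonneg_of_bisection {T : Set G} (hT : IsOpenBisection T) {k : G} (hk : k ∈ T) :
    ∃ q : ConvAlgebra G, (∀ x, q x ≠ 0 → x ∈ T) ∧
      (∀ x, (star q * q) x ≠ 0 → x ∈ units G) ∧ (∀ x, 0 ≤ ((star q * q) x).re) ∧
      0 < ((star q * q) (d k)).re := by
  obtain ⟨q, hq1, hq2, -⟩ := ConvAlgebra.exists_eq_one (isCompact_singleton (x := k)) hT.1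
    (Set.singleton_subset_iff.2 hk)
  have hr : ∀ a b, a ∈ T → b ∈ T → r a = r b → a = b := fun a b ha hb e => by
    simpa using hT.2.1.injective (a₁ := ⟨a, ha⟩) (a₂ := ⟨b, hb⟩) e
  have hd : ∀ a b, a ∈ T → b ∈ T → d a = d b → a = b := fun a b ha hb e => by
    simpa using hT.2.2.injective (a₁ := ⟨a, ha⟩) (a₂ := ⟨b, hb⟩) e
  have hval : ∀ x, (star q * q) x =
      ∑ᶠ h ∈ {h : G | d h = d x}, (starRingEnd ℂ) (q (h * x⁻¹)) * q h := by
    intro x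
    rw [ConvAlgebra.coe_mul, conv_eq_finsum_domain]
    refine finsum_mem_congr rfl fun h hh => ?_
    have hh : d h = d x := hh
    rw [ConvAlgebra.star_apply, mul_inv_rev' (by rw [r_inv, hh]), inv_inv']
  have hunit : ∀ x, (star q * q) x ≠ 0 → x ∈ units G := by
    intro x hx
    rw [hval] at hx
    obtain ⟨h, hh, hne⟩ := exists_ne_zero_of_finsum_mem_ne_zero hx
    have hh : d h = d x := hh
    have h1 := hq2 _ ((map_ne_zero _).1 (left_ne_zero_of_mul hne))
    have h2 := hq2 _ (right_ne_zero_of_mul hne)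
    -- Both `h * x⁻¹` and `h` lie in `T` and have the same range, so they coincide and `x⁻¹` is a
    -- unit.
    have h3 := eq_units_of_mul_self (by rw [hh, r_inv]) (hr _ _ h1 h2 (r_mul_inv hh))
    rw [← inv_inv' x, inv_eq_self h3]
    exact h3
  have hone : ∀ h ∈ T, (star q * q) (d h) = (starRingEnd ℂ) (q h) * q h := by
    intro h hh
    rw [hval, finsum_mem_eq_sum_of_inter_support_eq (t := {h}), Finset.sum_singleton,
      inv_eq_self (d_mem_units h), mul_d_self]
    ext l
    simp only [Set.mem_inter_iff, Set.mem_ofPred_eq, Function.mem_support, Finset.coe_singleton,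
      Set.mem_singleton_iff, d_eq_self (d_mem_units h)]
    refine and_congr_left fun hne => ⟨fun e => ?_, fun e => by rw [e]⟩
    exact hd _ _ (hq2 _ (right_ne_zero_of_mul hne)) hh e
  have hre : ∀ z : ℂ, ((starRingEnd ℂ) z * z).re = Complex.normSq z := fun z => by
    rw [mul_comm, Complex.mul_conj, Complex.ofReal_re]
  refine ⟨q, hq2, hunit, fun x => ?_, ?_⟩
  · by_cases hx : (star q * q) x = 0
    · rw [hx, Complex.zero_re]
    · have hxu := hunit x hx
      have hx' := hx
      rw [hval] at hx'
      obtain ⟨h, hh, hne⟩ := exists_ne_zero_of_finsum_mem_ne_zero hx'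
      have hh : d h = d x := hh
      rw [← d_eq_self hxu, ← hh, hone h (hq2 _ (right_ne_zero_of_mul hne)), hre]
      exact Complex.normSq_nonneg _
  · rw [hone k hk, hre, hq1 k rfl]
    simp

/-- Each source of an arrow in `K` is joined by an arrow to a unit in `W`; a bisection around it,
kept over `W`, gives an element `star q * q` of the ideal positive near that source. Compactness
leaves finitely many of these, and nonnegativity prevents cancellation in their sum. -/
theorem exists_pos_mem_ideal
    (hmul : ∀ a : ReducedCStarAlgebra G, ∀ x ∈ I, a * x ∈ I ∧ x * a ∈ I) (hG : IsMinimal G)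
    {W : Set G} (hW : IsOpen W) (hWne : (W ∩ units G).Nonempty)
    (hWI : ∀ q : ConvAlgebra G, (∀ x, q x ≠ 0 → r x ∈ W) → toReduced G q ∈ I)
    {K : Set G} (hK : IsCompact K) :
    ∃ e : ConvAlgebra G, toReduced G e ∈ I ∧ (∀ x, e x ≠ 0 → x ∈ units G) ∧
      (∀ x, 0 ≤ (e x).re) ∧ ∀ x ∈ K, 0 < (e (d x)).re := by
  refine hK.induction_on (p := fun K => ∃ e : ConvAlgebra G, toReduced G e ∈ I ∧
    (∀ x, e x ≠ 0 → x ∈ units G) ∧ (∀ x, 0 ≤ (e x).re) ∧ ∀ x ∈ K, 0 < (e (d x)).re) ?_ ?_ ?_ ?_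
  · refine ⟨0, ?_, fun x hx => absurd rfl hx, fun x => le_rfl, fun x hx => hx.elim⟩
    exact hWI 0 fun x hx => absurd rfl hx
  · rintro s t hst ⟨e, h1, h2, h3, h4⟩
    exact ⟨e, h1, h2, h3, fun x hx => h4 x (hst hx)⟩
  · rintro s t ⟨e, h1, h2, h3, h4⟩ ⟨e', h1', h2', h3', h4'⟩
    have hre : ∀ x, ((e + e') x).re = (e x).re + (e' x).re := fun x => Complex.add_re _ _
    refine ⟨e + e', ?_, fun x hx => ?_, fun x => ?_, fun x hx => ?_⟩
    · rw [toReduced_add]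
      exact I.add_mem h1 h1'
    · by_contra hxu
      refine hx ?_
      show e x + e' x = 0
      rw [not_not.1 (mt (h2 x) hxu), not_not.1 (mt (h2' x) hxu), add_zero]
    · rw [hre]
      exact add_nonneg (h3 x) (h3' x)
    · rw [hre]
      rcases hx with hx | hx
      · exact add_pos_of_pos_of_nonneg (h4 x hx) (h3' _)
      · exact add_pos_of_nonneg_of_pos (h3 _) (h4' x hx)
  · intro x _
    obtain ⟨k, hk, hkW⟩ := hG.exists_arrow hW hWne (d_mem_units x)
    obtain ⟨T, hT, hkT, hTW⟩ := exists_bisection k (hW.preimage continuous_r) hkW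
    obtain ⟨q, h1, h2, h3, h4⟩ := exists_nonneg_of_bisection hT hkT
    refine ⟨{y | 0 < ((star q * q) (d y)).re}, mem_nhdsWithin_of_mem_nhds ?_, star q * q, ?_, h2, h3,
      fun y hy => hy⟩
    · refine IsOpen.mem_nhds (isOpen_lt continuous_const
        (Complex.continuous_re.comp ((star q * q).continuous.comp continuous_d))) ?_
      rw [hk] at h4
      exact h4
    · rw [toReduced_mul]
      exact (hmul _ _ (hWI q fun y hy => hTW (h1 y hy))).1

/-- Right convolution by `e` is multiplication by `e ∘ d`, which can be divided out on the support
of `f`: hence `f = F * e` with `F = f / (e ∘ d)`. -/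
theorem toReduced_mem_ideal
    (hmul : ∀ a : ReducedCStarAlgebra G, ∀ x ∈ I, a * x ∈ I ∧ x * a ∈ I) {f e : ConvAlgebra G}
    (heI : toReduced G e ∈ I) (heu : ∀ x, e x ≠ 0 → x ∈ units G)
    (he : ∀ x ∈ tsupport f, e (d x) ≠ 0) : toReduced G f ∈ I := by
  -- Zeros of `e ∘ d` do no harm: they lie outside `tsupport f`, where the product is locally zero.
  have hcont : Continuous fun x => f x * (e (d x))⁻¹ := by
    rw [continuous_iff_continuousAt]
    intro x
    by_cases hx : x ∈ tsupport f
    · exact f.continuous.continuousAt.mul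
        ((e.continuous.comp continuous_d).continuousAt.inv₀ (he x hx))
    · refine ContinuousAt.congr (f := fun _ => 0) continuousAt_const ?_
      filter_upwards [(isClosed_tsupport f).isOpen_compl.mem_nhds hx] with y hy
      rw [image_eq_zero_of_notMem_tsupport hy, zero_mul]
  let F : ConvAlgebra G := ⟨⟨fun x => f x * (e (d x))⁻¹, hcont⟩, f.hasCompactSupport.mul_right⟩
  have hF : f = F * e := by
    refine ConvAlgebra.ext (funext fun x => ?_)
    rw [ConvAlgebra.coe_mul, conv_unitSupported_right heu]
    show f x = f x * (e (d x))⁻¹ * e (d x)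
    by_cases hx : x ∈ tsupport f
    · rw [inv_mul_cancel_right₀ (he x hx)]
    · rw [image_eq_zero_of_notMem_tsupport hx, zero_mul, zero_mul]
  rw [hF, toReduced_mul]
  exact (hmul _ _ heI).1

theorem eq_top_of_forall_toReduced_mem (hI : IsClosed (I : Set (ReducedCStarAlgebra G)))
    (h : ∀ f, toReduced G f ∈ I) : I = ⊤ := by
  refine Submodule.eq_top_iff'.2 fun a => ?_
  exact denseRange_toReduced.induction_on (p := fun a => a ∈ I) a hI h

theorem IsMinimal.isSimpleCStarAlgebra (hG : IsMinimal G) {u : G} (hu : u ∈ units G)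
    (hiso : isotropy u = {u}) : IsSimpleCStarAlgebra (ReducedCStarAlgebra G) := by
  constructor
  · obtain ⟨f, hf, -⟩ := ConvAlgebra.exists_eventually_eq_one (Filter.univ_mem (f := nhds u))
    refine ⟨⟨toReduced G f, 0, fun h0 => ?_⟩⟩
    have h1 := coeff_toReduced f u
    rw [h0, hf.self_of_nhds] at h1
    exact zero_ne_one h1
  · intro I hI hmul
    by_cases hne : I = ⊥
    · exact Or.inl hne
    · right
      obtain ⟨W, hW, hWne, hWI⟩ := exists_isOpen_forall_mem_ideal hG hu hiso hI hmul hne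
      refine eq_top_of_forall_toReduced_mem hI fun f => ?_
      obtain ⟨e, h1, h2, -, h4⟩ := exists_pos_mem_ideal hmul hG hW hWne hWI
        f.hasCompactSupport.isCompact
      refine toReduced_mem_ideal hmul h1 h2 fun x hx h0 => ?_
      have := h4 x hx
      rw [h0, Complex.zero_re] at this
      exact lt_irrefl _ this

/-! ### Simplicity implies minimality. -/

/-- The ideal of all elements of `C_r^*(G)` whose components over `D` vanish. -/
noncomputable def vanishingIdeal (D : Set (units G)) : Submodule ℂ (ReducedCStarAlgebra G) where
  carrier := {a | ∀ w ∈ D, a.1 w = 0}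
  zero_mem' := fun _ _ => rfl
  add_mem' := fun {a b} ha hb w hw => by
    show a.1 w + b.1 w = 0
    rw [ha w hw, hb w hw, add_zero]
  smul_mem' := fun c a ha w hw => by
    show c • a.1 w = 0
    rw [ha w hw, smul_zero]

theorem isClosed_vanishingIdeal (D : Set (units G)) :
    IsClosed (vanishingIdeal D : Set (ReducedCStarAlgebra G)) := by
  have : (vanishingIdeal D : Set (ReducedCStarAlgebra G)) = ⋂ w ∈ D, {a | a.1 w = 0} := by
    ext a
    simp only [Set.mem_iInter]
    rfl
  rw [this]
  refine isClosed_biInter fun w _ => isClosed_eq ?_ continuous_const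
  refine (LipschitzWith.of_dist_le_mul (K := 1) fun S T => ?_).continuous
  rw [dist_eq_norm, dist_eq_norm, NNReal.coe_one, one_mul]
  exact norm_apply_le (S - T).1 w

theorem vanishingIdeal_mul (D : Set (units G)) (a : ReducedCStarAlgebra G) :
    ∀ x ∈ vanishingIdeal D, a * x ∈ vanishingIdeal D ∧ x * a ∈ vanishingIdeal D := by
  intro x hx
  refine ⟨fun w hw => ?_, fun w hw => ?_⟩
  · show a.1 w * x.1 w = 0
    rw [hx w hw, mul_zero]
  · show x.1 w * a.1 w = 0
    rw [hx w hw, zero_mul]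

theorem IsSimpleCStarAlgebra.isMinimal (h : IsSimpleCStarAlgebra (ReducedCStarAlgebra G)) :
    IsMinimal G := by
  intro D hD hinv
  rcases h.2 (vanishingIdeal D) (isClosed_vanishingIdeal D) (vanishingIdeal_mul D) with hI | hI
  · right
    by_contra hne
    obtain ⟨v, hv⟩ := (Set.ne_univ_iff_exists_notMem D).1 hne
    obtain ⟨V, hV, hVD⟩ := isOpen_induced_iff.1 hD.isOpen_compl
    have hvV : v.1 ∈ V := by
      have : v ∈ Subtype.val ⁻¹' V := hVD ▸ hv
      exact this
    obtain ⟨p, hp1, hp2, -⟩ := ConvAlgebra.exists_eventually_eq_one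
      (((hV.inter (isOpen_units G)).mem_nhds ⟨hvV, v.2⟩))
    have hmem : toReduced G p ∈ vanishingIdeal D := by
      intro w hw
      show regRepOp w.1 p = 0
      ext ξ g
      rw [regRepOp_apply, conv_unitSupported_left fun x hx => (hp2 x hx).2]
      -- Invariance puts `r g` in `D`, because `d g = w` is in `D`, whereas `p` is supported off
      -- `D`.
      have h0 : p (r g.1) = 0 := by
        by_contra hne
        obtain ⟨w', hw', e⟩ := hinv g.1 ⟨w, hw, g.2.symm⟩
        have h1 : w' ∈ Subtype.val ⁻¹' V := by
          show w'.1 ∈ V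
          rw [e]
          exact (hp2 _ hne).1
        rw [hVD] at h1
        exact h1 hw'
      rw [h0, zero_mul]
      rfl
    rw [hI, Submodule.mem_bot] at hmem
    have h1 := coeff_toReduced p v.1
    rw [hmem, hp1.self_of_nhds] at h1
    exact zero_ne_one h1
  · left
    by_contra hne
    obtain ⟨w, hw⟩ := Set.nonempty_iff_ne_empty.2 hne
    obtain ⟨f, hf, -⟩ := ConvAlgebra.exists_eventually_eq_one (Filter.univ_mem (f := nhds w.1))
    have hmem : toReduced G f ∈ vanishingIdeal D := hI ▸ Submodule.mem_top
    have h0 : regRepFamily G f w = 0 := hmem w hw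
    -- The diagonal coefficient at the unit `w` is `f w = 1`, so the component of `f` over `w`
    -- cannot vanish.
    let e : {g : G // d g = w.1} := ⟨w.1, d_eq_self w.2⟩
    have h1 := matrixCoeff_regRepFamily w e e f
    have h2 : w.1 * w.1⁻¹ = w.1 := r_eq_self w.2
    rw [matrixCoeff, h0] at h1
    have h3 : (0 : ℂ) = f (w.1 * w.1⁻¹) := h1
    rw [h2, hf.self_of_nhds] at h3
    exact zero_ne_one h3

end Simplicity

end Gpd

theorem mainTheorem11 {G : Type*} [TopologicalSpace G] [Gpd.Groupoid G] [Gpd.IsEtale G]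
    (hG : ∃ u ∈ Gpd.units G, Gpd.isotropy u = {u}) :
    Gpd.IsSimpleCStarAlgebra (Gpd.ReducedCStarAlgebra G) ↔ Gpd.IsMinimal G := by
  obtain ⟨u, hu, hiso⟩ := hG
  exact ⟨fun h => h.isMinimal, fun h => h.isSimpleCStarAlgebra hu hiso⟩
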